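/- Theorem [Singular vectors distributions of Ginibre ensembles II]. Let $0<n\le m$ be integers, let $\mathbb F$ be $\mathbb R$, $\mathbb C$ or the quaternions $\mathbb H$, and put $\beta=1,2,4$ respectively. Write $\mathrm U(n,\mathbb F)=\{Q\in\mathbb F^{n\times n}:Q^{\mathsf H}Q=I\}$, i.e. $\mathrm O(n)$, $\mathrm U(n)$, $\mathrm{Sp}(n)$ respectively. Fix distinct reals $a_1,\dots,a_n$, let $\Delta_a=\operatorname{diag}(a_1,\dots,a_n)$, and let $$\mathrm V(n,\mathbb F^m)=\{X\in\mathbb F^{m\times n}:X^{\mathsf H}X=I\},\qquad \mathrm{Flag}(\mathbb F^n)=\{Q\Delta_aQ^{\mathsf H}:Q\in \mathrm U(n,\mathbb F)\}$$ be the Stiefel manifold and the complete flag manifold, the latter realized as a set of matrices. Let $\mathbb F^{m\times n}_\times$ be the set of all $Y\in\mathbb F^{m\times n}$ whose $n$ singular values are distinct and nonzero. For $Y\in\mathbb F^{m\times n}_\times$ let $Y=U\Sigma V^{\mathsf H}$ be a singular value decomposition, with $U\in\mathrm V(n,\mathbb F^m)$, $V\in \mathrm U(n,\mathbb F)$ and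 $\Sigma=\operatorname{diag}(\sigma_1,\dots,\sigma_n)$, $\sigma_1>\dots>\sigma_n>0$. Then $$\xi:\mathbb F^{m\times n}_\times\to \mathrm V(n,\mathbb F^m)\times\mathrm{Flag}(\mathbb F^n),\qquad Y\mapsto(UV^{\mathsf H},\,V\Delta_aV^{\mathsf H})$$ is well defined, i.e. its value does not depend on the choice of the decomposition. Let $Y$ be a random matrix distributed as $\mathrm{GinOE}(m,n)$ if $\mathbb F=\mathbb R$, as $\mathrm{GinUE}(m,n)$ if $\mathbb F=\mathbb C$, or as $\mathrm{GinSE}(m,n)$ if $\mathbb F=\mathbb H$, i.e. with density $(\beta/2\pi)^{mn\beta/2}e^{-\beta\operatorname{tr}(Y^{\mathsf H}Y)/2}$ with respect to Lebesgue measure on $\mathbb F^{m\times n}\cong\mathbb R^{\beta mn}$. Then $Y\in\mathbb F^{m\times n}_\times$ almost surely, and $\xi(Y)$ is uniformly distributed on $\mathrm V(n,\mathbb F^m)\times\mathrm{Flag}(\mathbb F^n)$. Here the uniform distribution is the unique probability measure on $\mathrm V(n,\mathbb F^m)\times\mathrm{Flag}(\mathbb F^n)$ that is invariant under the transitive action $(A,B)\cdot(X,F)=(AX,\,BFB^{\mathsf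 H})$ of $\mathrm U(m,\mathbb F)\times \mathrm U(n,\mathbb F)$. -/

import Mathlib

open MeasureTheory ProbabilityTheory
open scoped Matrix

namespace SingularVectors

/-! Throughout, `𝔽` stands for `ℝ`, `ℂ` or the skew field `ℍ = Quaternion ℝ`; the definitions are
uniform in `𝔽` and use only the structure that the three share. -/

/-! ### Borel structures -/

noncomputable instance : MeasurableSpace (Quaternion ℝ) := borel _

instance : BorelSpace (Quaternion ℝ) := ⟨rfl⟩

/-- The product (equivalently, Borel) σ-algebra on matrices. -/
instance {m n 𝔽 : Type*} [MeasurableSpace 𝔽] : MeasurableSpace (Matrix m n 𝔽) :=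
  inferInstanceAs (MeasurableSpace (m → n → 𝔽))

/-! ### Ginibre ensembles -/

/-- The squared Frobenius norm `∑ |y i j|²`, which is `tr (Yᴴ Y)`. -/
noncomputable def frobeniusSq {𝔽 : Type*} [Norm 𝔽] {m n : ℕ} (Y : Matrix (Fin m) (Fin n) 𝔽) : ℝ :=
  ∑ i, ∑ j, ‖Y i j‖ ^ 2

/-- Lebesgue measure on `𝔽^{m × n}`: the product over the entries of the Lebesgue measure of `𝔽`
(for `ℍ`, the `volume` of the inner product space `ℍ`, in which `1, i, j, k` are orthonormal). -/
noncomputable def lebesgue (𝔽 : Type*) [MeasureSpace 𝔽] (m n : ℕ) :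
    Measure (Matrix (Fin m) (Fin n) 𝔽) :=
  Measure.pi fun _ : Fin m => Measure.pi fun _ : Fin n => (volume : Measure 𝔽)

/-- The measure on `𝔽^{m × n}` with density `(β / 2π)^{mnβ/2} exp (-β tr (Yᴴ Y) / 2)`. -/
noncomputable def ginibre (𝔽 : Type*) [Norm 𝔽] [MeasureSpace 𝔽] (β : ℝ) (m n : ℕ) :
    Measure (Matrix (Fin m) (Fin n) 𝔽) :=
  (lebesgue 𝔽 m n).withDensity fun Y =>
    ENNReal.ofReal
      ((β / (2 * Real.pi)) ^ ((m : ℝ) * n * β / 2) * Real.exp (-(β / 2 * frobeniusSq Y)))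

/-- The Ginibre orthogonal ensemble. -/
noncomputable def GinOE (m n : ℕ) : Measure (Matrix (Fin m) (Fin n) ℝ) := ginibre ℝ 1 m n

/-- The Ginibre unitary ensemble. -/
noncomputable def GinUE (m n : ℕ) : Measure (Matrix (Fin m) (Fin n) ℂ) := ginibre ℂ 2 m n

/-- The Ginibre symplectic ensemble. -/
noncomputable def GinSE (m n : ℕ) : Measure (Matrix (Fin m) (Fin n) (Quaternion ℝ)) :=
  ginibre (Quaternion ℝ) 4 m n

/-! ### Unitary groups, Stiefel manifolds and complete flag manifolds -/

section Manifolds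

variable (𝔽 : Type*) [Ring 𝔽] [StarRing 𝔽]

/-- The group `{Q ∈ 𝔽^{n × n} : Qᴴ Q = Q Qᴴ = 1}`: `O(n)`, `U(n)` or the compact `Sp(n)`. -/
abbrev UnitaryGroup (n : ℕ) : Type _ := unitary (Matrix (Fin n) (Fin n) 𝔽)

/-- The Stiefel manifold `V(k, 𝔽ⁿ)` of orthonormal `k`-frames in `𝔽ⁿ`, as `n × k` matrices. -/
def Stiefel (k n : ℕ) : Set (Matrix (Fin n) (Fin k) 𝔽) := {X | Xᴴ * X = 1}

/-- The real diagonal matrix `diag (a₁, …, aₙ)` with entries regarded in `𝔽`. -/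
def realDiagonal [Algebra ℝ 𝔽] {n : ℕ} (a : Fin n → ℝ) : Matrix (Fin n) (Fin n) 𝔽 :=
  Matrix.diagonal fun i => algebraMap ℝ 𝔽 (a i)

/-- The complete flag manifold `Flag(𝔽ⁿ)`, realized as `{Q diag(a) Qᴴ : Q unitary}` for a fixed
vector `a` (with distinct entries). -/
def CompleteFlag [Algebra ℝ 𝔽] {n : ℕ} (a : Fin n → ℝ) : Set (Matrix (Fin n) (Fin n) 𝔽) :=
  {X | ∃ Q : UnitaryGroup 𝔽 n, X = Q.1 * realDiagonal 𝔽 a * Q.1ᴴ}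

/-- The unitary group acts on `V(k, 𝔽ⁿ)` by left multiplication, `(A, X) ↦ A X`. -/
instance (k n : ℕ) : MulAction (UnitaryGroup 𝔽 n) (Stiefel 𝔽 k n) where
  smul A X := ⟨A.1 * X.1, by
    have hA : A.1ᴴ * A.1 = 1 := (Unitary.mem_iff.mp A.2).1
    have hX : X.1ᴴ * X.1 = 1 := X.2
    change (A.1 * X.1)ᴴ * (A.1 * X.1) = 1
    rw [Matrix.conjTranspose_mul, Matrix.mul_assoc, ← Matrix.mul_assoc _ A.1, hA,
      Matrix.one_mul, hX]⟩
  one_smul X := Subtype.ext (Matrix.one_mul X.1)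
  mul_smul A B X := Subtype.ext (Matrix.mul_assoc A.1 B.1 X.1)

/-- The unitary group acts on `Flag(𝔽ⁿ)` by conjugation, `(B, F) ↦ B F Bᴴ`. -/
instance [Algebra ℝ 𝔽] {n : ℕ} (a : Fin n → ℝ) :
    MulAction (UnitaryGroup 𝔽 n) (CompleteFlag 𝔽 a) where
  smul B F := ⟨B.1 * F.1 * B.1ᴴ, by
    obtain ⟨F, Q, rfl⟩ := F
    refine ⟨B * Q, ?_⟩
    change B.1 * (Q.1 * realDiagonal 𝔽 a * Q.1ᴴ) * B.1ᴴ
      = (B.1 * Q.1) * realDiagonal 𝔽 a * (B.1 * Q.1)ᴴ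
    simp only [Matrix.conjTranspose_mul, Matrix.mul_assoc]⟩
  one_smul F := Subtype.ext (by
    change (1 : Matrix (Fin n) (Fin n) 𝔽) * F.1 * (1 : Matrix (Fin n) (Fin n) 𝔽)ᴴ = F.1
    simp)
  mul_smul A B F := Subtype.ext (by
    change (A.1 * B.1) * F.1 * (A.1 * B.1)ᴴ = A.1 * (B.1 * F.1 * B.1ᴴ) * A.1ᴴ
    simp only [Matrix.conjTranspose_mul, Matrix.mul_assoc])

/-- The product action of the product group on `V(k, 𝔽ᵐ) × Flag(𝔽ⁿ)`, which makes it a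
homogeneous space: `(A, B) • (X, F) = (A X, B F Bᴴ)`. -/
instance [Algebra ℝ 𝔽] (k m : ℕ) {n : ℕ} (a : Fin n → ℝ) :
    MulAction (UnitaryGroup 𝔽 m × UnitaryGroup 𝔽 n) (Stiefel 𝔽 k m × CompleteFlag 𝔽 a) where
  smul g p := (g.1 • p.1, g.2 • p.2)
  one_smul p := Prod.ext (one_smul _ p.1) (one_smul _ p.2)
  mul_smul g h p := Prod.ext (mul_smul g.1 h.1 p.1) (mul_smul g.2 h.2 p.2)

end Manifolds

/-- `μ` is the uniform distribution of the homogeneous `G`-space `X`: the unique `G`-invariant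
probability measure on `X`. -/
def IsUniform (G : Type*) {X : Type*} [Group G] [MulAction G X] [MeasurableSpace X]
    (μ : Measure X) : Prop :=
  (IsProbabilityMeasure μ ∧ SMulInvariantMeasure G X μ) ∧
    ∀ ν : Measure X, IsProbabilityMeasure ν → SMulInvariantMeasure G X ν → ν = μ

/-- The random variable `Z` on `(Ω, P)` is uniformly distributed on the homogeneous `G`-space
`X`. -/
def IsUniformlyDistributed (G : Type*) {X Ω : Type*} [Group G] [MulAction G X]
    [MeasurableSpace X] [MeasurableSpace Ω] (Z : Ω → X) (P : Measure Ω) : Prop :=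
  AEMeasurable Z P ∧ IsUniform G (P.map Z)

/-! ### Singular value decompositions -/

section SVD

variable {𝔽 : Type*} [Ring 𝔽] [StarRing 𝔽] [Algebra ℝ 𝔽] {m n : ℕ}

/-- `Y = U diag(σ) Vᴴ` is a (thin) singular value decomposition of `Y ∈ 𝔽^{m × n}`, `n ≤ m`:
the columns of `U ∈ 𝔽^{m × n}` are orthonormal, `V` is unitary, and `σ₁ ≥ ⋯ ≥ σₙ ≥ 0`. -/
structure IsSVD (Y U : Matrix (Fin m) (Fin n) 𝔽) (σ : Fin n → ℝ)
    (V : Matrix (Fin n) (Fin n) 𝔽) : Prop where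
  left_mem : U ∈ Stiefel 𝔽 n m
  right_mem : V ∈ unitary (Matrix (Fin n) (Fin n) 𝔽)
  nonneg : ∀ i, 0 ≤ σ i
  antitone : Antitone σ
  eq : Y = U * realDiagonal 𝔽 σ * Vᴴ

variable (𝔽 m n) in
/-- The matrices of size `m × n`, `n ≤ m`, whose `n` singular values are distinct and nonzero. -/
def Regular : Set (Matrix (Fin m) (Fin n) 𝔽) :=
  {Y | ∃ U σ V, IsSVD Y U σ V ∧ Function.Injective σ ∧ ∀ i, σ i ≠ 0}

/-- `ξ` is the map `Y ↦ (U Vᴴ, V diag(a) Vᴴ)`, where `Y = U diag(σ) Vᴴ` is any singular value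
decomposition; every `Y` in the domain has one, so this determines `ξ`, and the existence of
such a `ξ` says that the value does not depend on the choice of the decomposition. -/
def IsSingularVectorsMap (a : Fin n → ℝ) (ξ : Regular 𝔽 m n → Stiefel 𝔽 n m × CompleteFlag 𝔽 a) :
    Prop :=
  ∀ (Y : Regular 𝔽 m n) (U : Matrix (Fin m) (Fin n) 𝔽) (σ : Fin n → ℝ)
    (V : Matrix (Fin n) (Fin n) 𝔽), IsSVD Y.1 U σ V →
      (ξ Y).1.1 = U * Vᴴ ∧ (ξ Y).2.1 = V * realDiagonal 𝔽 a * Vᴴ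

/-- `Z` is (a version of) the random variable `ξ(Y)`: almost surely `Y` lies in the domain of
`ξ` and `Z = ξ(Y)`. -/
def IsVersion {Ω D T : Type*} {S : Set D} [MeasurableSpace Ω] (P : Measure Ω)
    (ξ : S → T) (Y : Ω → D) (Z : Ω → T) : Prop :=
  ∀ᵐ ω ∂P, ∃ h : Y ω ∈ S, Z ω = ξ ⟨Y ω, h⟩

end SVD

end SingularVectors

open SingularVectors

namespace SingularVectors

/-! For unitary `A`, `B` the map `Y ↦ A Y Bᴴ` is linear and preserves the Frobenius norm, so it
preserves the Ginibre law. An SVD `(U, σ, V)` of `Y` becomes `(A U, σ, B V)`, so `ξ(Y) = (X, F)`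
becomes `(A X Bᴴ, B F Bᴴ)`. Taking `B = 1`, the law of `ξ(Y)` is invariant under left multiplication
on the Stiefel factor alone. Averaging over the compact transitive group `U(m, 𝔽)` forces the law to
be the product of the uniform law on the Stiefel manifold with its flag marginal
(`eq_prod_of_transitive`). Taking `A = 1`, that marginal is conjugation invariant, hence uniform
(`eq_map_of_transitive`); independence makes the extra factor `Bᴴ` on the Stiefel side harmless.

The map `ξ` is well defined because two SVDs of a regular `Y` differ by a unitary that commutes with
every real diagonal matrix, and `U Vᴴ` is the polar factor `Y (Yᴴ Y)^(-1/2)`. Regularity is the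
nonvanishing of a real polynomial in `Y`, `momentDet`, which gives almost sure regularity;
compactness of the manifolds gives continuity of `ξ`.

The three cases are treated at once through `HermitianScalars`. Over `ℍ` neither the determinant nor
a cyclic trace is at hand: real parts of traces and real symmetric eigenvectors replace them. -/

set_option linter.unusedSectionVars false

/-- A normed real star algebra with a real part functional that makes `(x, y) ↦ re (star x * y)` an
inner product inducing the norm. The algebras `ℝ`, `ℂ` and `ℍ` are of this kind. -/
class HermitianScalars (𝔽 : Type*) [NormedRing 𝔽] [StarRing 𝔽] [NormedAlgebra ℝ 𝔽] where
  re : 𝔽 →ₗ[ℝ] ℝ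
  re_one : re 1 = 1
  re_mul_comm : ∀ x y, re (x * y) = re (y * x)
  re_star : ∀ x, re (star x) = re x
  star_mul_self : ∀ x : 𝔽, star x * x = algebraMap ℝ 𝔽 (‖x‖ ^ 2)

open HermitianScalars

/-- `B` is turned into a local inner product, for which `T` is self-adjoint; the supremum of the
Rayleigh quotient is then an eigenvalue. -/
theorem exists_eigenvector_of_symmetric {E : Type*} [AddCommGroup E] [Module ℝ E]
    [FiniteDimensional ℝ E] [Nontrivial E] (B : LinearMap.BilinForm ℝ E)
    (hsymm : ∀ x y, B x y = B y x) (hpos : ∀ x, x ≠ 0 → 0 < B x x) (T : E →ₗ[ℝ] E)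
    (hT : ∀ x y, B (T x) y = B x (T y)) : ∃ μ : ℝ, ∃ x ≠ 0, T x = μ • x := by
  let c : InnerProductSpace.Core ℝ E :=
    { inner := fun x y => B x y
      conj_inner_symm := fun x y => hsymm y x
      re_inner_nonneg := fun x => by
        rcases eq_or_ne x 0 with rfl | h
        · simp
        · exact (hpos x h).le
      add_left := fun x y z => by simp
      smul_left := fun x y r => by simp
      definite := fun x hx => by
        by_contra h
        exact (hpos x h).ne' hx }
  let _ : NormedAddCommGroup E := c.toNormedAddCommGroup
  let _ : InnerProductSpace ℝ E := InnerProductSpace.ofCore c.toCore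
  have hS : T.IsSymmetric := hT
  obtain ⟨x, hx⟩ := hS.hasEigenvalue_iSup_of_finiteDimensional.exists_hasEigenvector
  exact ⟨_, x, hx.2, hx.apply_eq_smul⟩

/-! ### Scalars, real diagonal matrices and the real trace -/

section Scalars

variable {𝔽 : Type*} [NormedRing 𝔽] [StarRing 𝔽] [NormedAlgebra ℝ 𝔽] [HermitianScalars 𝔽]

@[simp] theorem re_algebraMap (r : ℝ) : re (algebraMap ℝ 𝔽 r) = r := by
  simp [Algebra.algebraMap_eq_smul_one, re_one]

theorem re_star_mul_self (x : 𝔽) : re (star x * x) = ‖x‖ ^ 2 := by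
  rw [star_mul_self, re_algebraMap]

theorem algebraMap_real_injective : Function.Injective (algebraMap ℝ 𝔽) := fun a b h => by
  simpa using congrArg (re : 𝔽 →ₗ[ℝ] ℝ) h

end Scalars

section Diagonal

variable {𝔽 : Type*} [Ring 𝔽] [Algebra ℝ 𝔽] {n : ℕ}

theorem realDiagonal_mul (a b : Fin n → ℝ) :
    realDiagonal 𝔽 a * realDiagonal 𝔽 b = realDiagonal 𝔽 fun i => a i * b i := by
  simp [realDiagonal, Matrix.diagonal_mul_diagonal]

theorem realDiagonal_one : realDiagonal 𝔽 (fun _ : Fin n => (1 : ℝ)) = 1 := by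
  simp [realDiagonal]

theorem conjTranspose_realDiagonal [StarRing 𝔽] [StarModule ℝ 𝔽] (a : Fin n → ℝ) :
    (realDiagonal 𝔽 a)ᴴ = realDiagonal 𝔽 a := by
  rw [realDiagonal, Matrix.diagonal_conjTranspose]
  congr 1
  ext i
  simp [← algebraMap_star_comm]

end Diagonal

theorem eq_zero_of_frobeniusSq {𝔽 : Type*} [NormedRing 𝔽] {m n : ℕ}
    {Y : Matrix (Fin m) (Fin n) 𝔽} (h : frobeniusSq Y = 0) :
    Y = 0 := by
  rw [frobeniusSq, Finset.sum_eq_zero_iff_of_nonneg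
    fun i _ => Finset.sum_nonneg fun j _ => by positivity] at h
  ext i j
  have := h i (Finset.mem_univ _)
  rw [Finset.sum_eq_zero_iff_of_nonneg fun j _ => by positivity] at this
  simpa using this j (Finset.mem_univ _)

section RealTrace

variable {𝔽 : Type*} [NormedRing 𝔽] [StarRing 𝔽] [NormedAlgebra ℝ 𝔽] [HermitianScalars 𝔽]
variable {l m n : ℕ}

/-- The real part of the trace. -/
noncomputable def reTrace (M : Matrix (Fin n) (Fin n) 𝔽) : ℝ := re M.trace

/-- Over `ℍ` the trace is not cyclic, but its real part is, since `re (x * y) = re (y * x)`. -/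
theorem reTrace_mul_comm (A : Matrix (Fin m) (Fin n) 𝔽) (B : Matrix (Fin n) (Fin m) 𝔽) :
    reTrace (A * B) = reTrace (B * A) := by
  simp only [reTrace, Matrix.trace, Matrix.diag, Matrix.mul_apply, map_sum]
  rw [Finset.sum_comm]
  exact Finset.sum_congr rfl fun i _ => Finset.sum_congr rfl fun j _ => re_mul_comm _ _

theorem reTrace_conjTranspose (A : Matrix (Fin n) (Fin n) 𝔽) : reTrace Aᴴ = reTrace A := by
  simp [reTrace, Matrix.trace, re_star]

theorem reTrace_realDiagonal (a : Fin n → ℝ) : reTrace (realDiagonal 𝔽 a) = ∑ i, a i := by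
  simp [reTrace, Matrix.trace, realDiagonal]

theorem frobeniusSq_eq_reTrace (Y : Matrix (Fin m) (Fin n) 𝔽) :
    frobeniusSq Y = reTrace (Yᴴ * Y) := by
  simp only [reTrace, Matrix.trace, Matrix.diag, Matrix.mul_apply, map_sum, frobeniusSq,
    Matrix.conjTranspose_apply, re_star_mul_self]
  exact Finset.sum_comm

theorem frobeniusSq_mul_left {A : Matrix (Fin l) (Fin m) 𝔽} (hA : Aᴴ * A = 1)
    (Y : Matrix (Fin m) (Fin n) 𝔽) : frobeniusSq (A * Y) = frobeniusSq Y := by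
  rw [frobeniusSq_eq_reTrace, frobeniusSq_eq_reTrace, Matrix.conjTranspose_mul, Matrix.mul_assoc,
    ← Matrix.mul_assoc _ A, hA, Matrix.one_mul]

theorem frobeniusSq_mul_right {B : Matrix (Fin n) (Fin l) 𝔽} (hB : B * Bᴴ = 1)
    (Y : Matrix (Fin m) (Fin n) 𝔽) : frobeniusSq (Y * B) = frobeniusSq Y := by
  rw [frobeniusSq_eq_reTrace, frobeniusSq_eq_reTrace, reTrace_mul_comm, reTrace_mul_comm Yᴴ,
    Matrix.conjTranspose_mul, Matrix.mul_assoc, ← Matrix.mul_assoc B, hB, Matrix.one_mul]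

end RealTrace

/-- `𝔽` need not be commutative, so finite dimension over `ℝ`, through the Noetherian property,
takes the place of determinants. -/
theorem mul_eq_one_comm_matrix {𝔽 : Type*} [NormedRing 𝔽] [NormedAlgebra ℝ 𝔽]
    [FiniteDimensional ℝ 𝔽] {n : ℕ} {A B : Matrix (Fin n) (Fin n) 𝔽} (h : A * B = 1) : B * A = 1 := by
  have : IsNoetherianRing 𝔽 := IsNoetherianRing.of_finite ℝ 𝔽
  exact mul_eq_one_symm h

/-! ### Spectral theorem and completion of orthonormal frames -/

section Spectral

variable {𝔽 : Type*} [NormedRing 𝔽] [StarRing 𝔽] [NormedAlgebra ℝ 𝔽] [HermitianScalars 𝔽]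
variable [StarModule ℝ 𝔽] [FiniteDimensional ℝ 𝔽] {k m n : ℕ}

/-- `H` preserves the real space `ker Xᴴ`, because `Xᴴ H = diag(d) Xᴴ`, and is symmetric there for
the real trace form. Working over `ℝ` makes the eigenvalue real, hence central in `𝔽`. -/
theorem exists_orthogonal_eigenvector {H : Matrix (Fin m) (Fin m) 𝔽} (hH : Hᴴ = H)
    {X : Matrix (Fin m) (Fin k) 𝔽} {d : Fin k → ℝ} (hHX : H * X = X * realDiagonal 𝔽 d)
    (hk : k < m) :
    ∃ (w : Matrix (Fin m) (Fin 1) 𝔽) (μ : ℝ), Xᴴ * w = 0 ∧ wᴴ * w = 1 ∧ H * w = μ • w := by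
  let φ : Matrix (Fin m) (Fin 1) 𝔽 →ₗ[ℝ] Matrix (Fin k) (Fin 1) 𝔽 :=
    { toFun := fun w => Xᴴ * w
      map_add' := fun _ _ => Matrix.mul_add _ _ _
      map_smul' := fun _ _ => Matrix.mul_smul _ _ _ }
  let W := LinearMap.ker φ
  have hXH : Xᴴ * H = realDiagonal 𝔽 d * Xᴴ := by
    have := congrArg Matrix.conjTranspose hHX
    rwa [Matrix.conjTranspose_mul, Matrix.conjTranspose_mul, hH, conjTranspose_realDiagonal] at this
  have hnt : Nontrivial 𝔽 := algebraMap_real_injective.nontrivial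
  have hpos : 0 < Module.finrank ℝ 𝔽 := Module.finrank_pos
  have : Nontrivial W := by
    have hlt : Module.finrank ℝ (Matrix (Fin k) (Fin 1) 𝔽)
        < Module.finrank ℝ (Matrix (Fin m) (Fin 1) 𝔽) := by
      simp only [Module.finrank_matrix, Fintype.card_fin]
      nlinarith
    obtain ⟨x, hx, hx0⟩ := Submodule.exists_mem_ne_zero_of_ne_bot
      (LinearMap.ker_ne_bot_of_finrank_lt (f := φ) hlt)
    exact ⟨⟨x, hx⟩, 0, fun h => hx0 (congrArg Subtype.val h)⟩
  let T : W →ₗ[ℝ] W :=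
    { toFun := fun w => ⟨H * w.1, by
        have hw : Xᴴ * w.1 = 0 := w.2
        change Xᴴ * (H * w.1) = 0
        rw [← Matrix.mul_assoc, hXH, Matrix.mul_assoc, hw, Matrix.mul_zero]⟩
      map_add' := fun _ _ => Subtype.ext (Matrix.mul_add _ _ _)
      map_smul' := fun _ _ => Subtype.ext (Matrix.mul_smul _ _ _) }
  let B : LinearMap.BilinForm ℝ W := LinearMap.mk₂ ℝ (fun x y => reTrace (x.1ᴴ * y.1))
    (fun x y z => by simp [reTrace, Matrix.add_mul])
    (fun c x y => by simp [reTrace])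
    (fun x y z => by simp [reTrace, Matrix.mul_add])
    (fun c x y => by simp [reTrace])
  obtain ⟨μ, w, hw0, hw⟩ := exists_eigenvector_of_symmetric B
    (fun x y => by
      change reTrace (x.1ᴴ * y.1) = reTrace (y.1ᴴ * x.1)
      rw [← reTrace_conjTranspose, Matrix.conjTranspose_mul, Matrix.conjTranspose_conjTranspose])
    (fun x hx => by
      change 0 < reTrace (x.1ᴴ * x.1)
      rw [← frobeniusSq_eq_reTrace]
      refine lt_of_le_of_ne (Finset.sum_nonneg fun i _ => Finset.sum_nonneg fun j _ => by positivity)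
        fun h => hx (Subtype.ext (eq_zero_of_frobeniusSq h.symm)))
    T
    (fun x y => by
      change reTrace ((H * x.1)ᴴ * y.1) = reTrace (x.1ᴴ * (H * y.1))
      rw [Matrix.conjTranspose_mul, hH, Matrix.mul_assoc])
  -- The single entry of `wᴴ w` is a real scalar, so a real rescaling normalizes `w`.
  have hww : w.1ᴴ * w.1 = algebraMap ℝ 𝔽 (frobeniusSq w.1) • (1 : Matrix (Fin 1) (Fin 1) 𝔽) := by
    ext i j
    fin_cases i; fin_cases j
    simp [Matrix.mul_apply, frobeniusSq, star_mul_self]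
  have hf : 0 < frobeniusSq w.1 :=
    lt_of_le_of_ne (Finset.sum_nonneg fun i _ => Finset.sum_nonneg fun j _ => by positivity)
      fun h => hw0 (Subtype.ext (eq_zero_of_frobeniusSq h.symm))
  have hwX : Xᴴ * w.1 = 0 := w.2
  have hwH : H * w.1 = μ • w.1 := congrArg Subtype.val hw
  refine ⟨(√(frobeniusSq w.1))⁻¹ • w.1, μ, ?_, ?_, ?_⟩
  · rw [Matrix.mul_smul, hwX, smul_zero]
  · rw [Matrix.conjTranspose_smul, Matrix.mul_smul, Matrix.smul_mul, hww, smul_smul,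
      algebraMap_smul, smul_smul, star_trivial, ← mul_inv, Real.mul_self_sqrt hf.le,
      inv_mul_cancel₀ hf.ne', one_smul]
  · rw [Matrix.mul_smul, hwH, smul_comm]

/-- Eigenvectors are appended one at a time, by induction on the number `e` of missing columns. An
empty frame yields the spectral theorem; `H = 0` yields the completion of any frame to a unitary
matrix. -/
theorem exists_unitary_extension {H : Matrix (Fin m) (Fin m) 𝔽} (hH : Hᴴ = H) (e : ℕ) :
    ∀ {k : ℕ} (hk : k ≤ m) (X : Matrix (Fin m) (Fin k) 𝔽) (d : Fin k → ℝ), m = k + e →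
      Xᴴ * X = 1 → H * X = X * realDiagonal 𝔽 d →
      ∃ (Q : Matrix (Fin m) (Fin m) 𝔽) (d' : Fin m → ℝ), Qᴴ * Q = 1 ∧
        H * Q = Q * realDiagonal 𝔽 d' ∧ ∀ i (j : Fin k), Q i (Fin.castLE hk j) = X i j := by
  induction e with
  | zero =>
    intro k hk X d hm hX hHX
    obtain rfl : m = k := by omega
    exact ⟨X, d, hX, hHX, fun i j => rfl⟩
  | succ e ih =>
    intro k hk X d hm hX hHX
    obtain ⟨w, μ, hXw, hww, hHw⟩ := exists_orthogonal_eigenvector hH hHX (by omega)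
    have hwX : wᴴ * X = 0 := by
      have := congrArg Matrix.conjTranspose hXw
      rwa [Matrix.conjTranspose_mul, Matrix.conjTranspose_conjTranspose,
        Matrix.conjTranspose_zero] at this
    let X' : Matrix (Fin m) (Fin (k + 1)) 𝔽 := fun i => Fin.snoc (α := fun _ => 𝔽) (X i) (w i 0)
    let d' : Fin (k + 1) → ℝ := Fin.snoc (α := fun _ => ℝ) d μ
    have hc : ∀ i j, X' i (Fin.castSucc j) = X i j := fun i j => by simp [X']
    have hl : ∀ i, X' i (Fin.last k) = w i 0 := fun i => by simp [X']
    obtain ⟨Q, d'', hQ, hHQ, hQX⟩ := ih (k := k + 1) (by omega) X' d' (by omega) (by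
      ext a b
      rw [Matrix.mul_apply]
      refine Fin.lastCases ?_ (fun a => ?_) a <;> refine Fin.lastCases ?_ (fun b => ?_) b
      · simpa [Matrix.mul_apply, hl] using congrFun (congrFun hww 0) 0
      · simpa [Matrix.mul_apply, hl, hc, Matrix.one_apply, (Fin.castSucc_ne_last b).symm]
          using congrFun (congrFun hwX 0) b
      · simpa [Matrix.mul_apply, hl, hc, Matrix.one_apply, (Fin.castSucc_ne_last a)]
          using congrFun (congrFun hXw a) 0
      · simpa [Matrix.mul_apply, hc, Matrix.one_apply] using congrFun (congrFun hX a) b) (by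
      ext a b
      rw [realDiagonal, Matrix.mul_diagonal, Matrix.mul_apply]
      refine Fin.lastCases ?_ (fun b => ?_) b
      · simpa [Matrix.mul_apply, hl, d', Algebra.smul_def, ← Algebra.commutes]
          using congrFun (congrFun hHw a) 0
      · simpa [Matrix.mul_apply, hc, d', realDiagonal, Matrix.diagonal_apply]
          using congrFun (congrFun hHX a) b)
    exact ⟨Q, d'', hQ, hHQ, fun i j => (hQX i j.castSucc).trans (hc i j)⟩

theorem exists_unitary_diagonalization {H : Matrix (Fin n) (Fin n) 𝔽} (hH : Hᴴ = H) :
    ∃ (V : UnitaryGroup 𝔽 n) (d : Fin n → ℝ), H = V.1 * realDiagonal 𝔽 d * V.1ᴴ := by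
  obtain ⟨Q, d, hQ, hHQ, -⟩ := exists_unitary_extension hH n (Nat.zero_le n)
    (Matrix.of fun _ => Fin.elim0) Fin.elim0 (by simp) (by ext a; exact a.elim0)
    (by ext a b; exact b.elim0)
  have hQ' := mul_eq_one_comm_matrix hQ
  exact ⟨⟨Q, Unitary.mem_iff.mpr ⟨hQ, hQ'⟩⟩, d, by
    rw [← hHQ, Matrix.mul_assoc, hQ', Matrix.mul_one]⟩

theorem exists_unitary_mul_eq (hkm : k ≤ m) (X Y : Stiefel 𝔽 k m) :
    ∃ A : UnitaryGroup 𝔽 m, A • X = Y := by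
  have key : ∀ X : Stiefel 𝔽 k m, ∃ Q : UnitaryGroup 𝔽 m, ∀ i j,
      Q.1 i (Fin.castLE hkm j) = X.1 i j := fun X => by
    obtain ⟨Q, d, hQ, -, hQX⟩ := exists_unitary_extension (H := (0 : Matrix (Fin m) (Fin m) 𝔽))
      (by simp) (m - k) hkm X.1 0 (by omega) X.2 (by simp [realDiagonal])
    exact ⟨⟨Q, Unitary.mem_iff.mpr ⟨hQ, mul_eq_one_comm_matrix hQ⟩⟩, hQX⟩
  obtain ⟨P, hP⟩ := key X
  obtain ⟨Q, hQ⟩ := key Y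
  -- `P` and `Q` complete `X` and `Y`, so `P⁻¹` carries `X` to the first `k` standard basis columns
  -- and `Q` carries these to `Y`.
  refine ⟨Q * P⁻¹, Subtype.ext ?_⟩
  change Q.1 * P.1ᴴ * X.1 = Y.1
  have hP' : P.1ᴴ * P.1 = 1 := (Unitary.mem_iff.mp P.2).1
  have hX : P.1ᴴ * X.1 = Matrix.of fun i j => if i = Fin.castLE hkm j then 1 else 0 := by
    ext i j
    simpa [Matrix.mul_apply, hP, Matrix.one_apply]
      using congrFun (congrFun hP' i) (Fin.castLE hkm j)
  rw [Matrix.mul_assoc, hX]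
  ext i j
  simp [Matrix.mul_apply, hQ]

end Spectral

/-! ### A polynomial detecting regular matrices -/

section Discriminant

variable {𝔽 : Type*} [NormedRing 𝔽] [StarRing 𝔽] [NormedAlgebra ℝ 𝔽] [HermitianScalars 𝔽]
variable {m n : ℕ}

/-- The determinant of the moments `Re tr (Yᴴ Y) ^ (i + j + 2)`; it vanishes exactly when two
singular values of `Y` agree or one of them is zero. -/
noncomputable def momentDet (Y : Matrix (Fin m) (Fin n) 𝔽) : ℝ :=
  Matrix.det (Matrix.of fun i j : Fin n => reTrace ((Yᴴ * Y) ^ ((i : ℕ) + j + 2)))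

theorem pow_conj_realDiagonal (V : UnitaryGroup 𝔽 n) (d : Fin n → ℝ) (k : ℕ) :
    (V.1 * realDiagonal 𝔽 d * V.1ᴴ) ^ k = V.1 * realDiagonal 𝔽 (fun i => d i ^ k) * V.1ᴴ := by
  obtain ⟨h1, h2⟩ := Unitary.mem_iff.mp V.2
  change V.1ᴴ * V.1 = 1 at h1
  change V.1 * V.1ᴴ = 1 at h2
  induction k with
  | zero => simp [realDiagonal_one, h2]
  | succ k ih =>
    rw [pow_succ, ih]
    simp_rw [pow_succ, ← realDiagonal_mul]
    simp only [Matrix.mul_assoc]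
    rw [← Matrix.mul_assoc V.1ᴴ V.1, h1, Matrix.one_mul]

theorem reTrace_conj (V : UnitaryGroup 𝔽 n) (d : Fin n → ℝ) :
    reTrace (V.1 * realDiagonal 𝔽 d * V.1ᴴ) = ∑ i, d i := by
  have h1 : V.1ᴴ * V.1 = 1 := (Unitary.mem_iff.mp V.2).1
  rw [reTrace_mul_comm, ← Matrix.mul_assoc, h1, Matrix.one_mul, reTrace_realDiagonal]

/-- The moments are the power sums `∑ d l ^ (i + j + 2)`, so `momentDet Y` is the square of `∏ d l`
times the Vandermonde determinant of `d`. -/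
theorem momentDet_ne_zero_iff {Y : Matrix (Fin m) (Fin n) 𝔽} {V : UnitaryGroup 𝔽 n}
    {d : Fin n → ℝ} (h : Yᴴ * Y = V.1 * realDiagonal 𝔽 d * V.1ᴴ) :
    momentDet Y ≠ 0 ↔ Function.Injective d ∧ ∀ i, d i ≠ 0 := by
  let M : Matrix (Fin n) (Fin n) ℝ := (Matrix.vandermonde d)ᵀ * Matrix.diagonal d
  have : (Matrix.of fun i j : Fin n => reTrace ((Yᴴ * Y) ^ ((i : ℕ) + j + 2))) = M * Mᵀ := by
    ext i j
    rw [Matrix.of_apply, h, pow_conj_realDiagonal, reTrace_conj, Matrix.mul_apply]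
    refine Finset.sum_congr rfl fun l _ => ?_
    simp only [M, Matrix.transpose_apply, Matrix.mul_diagonal, Matrix.vandermonde_apply]
    ring
  rw [momentDet, this, Matrix.det_mul, Matrix.det_transpose, mul_self_ne_zero, Matrix.det_mul,
    Matrix.det_transpose, Matrix.det_diagonal, mul_ne_zero_iff, Matrix.det_vandermonde_ne_zero_iff,
    Finset.prod_ne_zero_iff]
  simp

end Discriminant

/-! ### Uniqueness, existence and equivariance of singular vectors -/

section SVD

variable {𝔽 : Type*} [NormedRing 𝔽] [StarRing 𝔽] [NormedAlgebra ℝ 𝔽] [HermitianScalars 𝔽]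
variable [StarModule ℝ 𝔽] {m n : ℕ} {Y U U' : Matrix (Fin m) (Fin n) 𝔽} {σ σ' : Fin n → ℝ}
variable {V V' : Matrix (Fin n) (Fin n) 𝔽}

theorem IsSVD.conjTranspose_mul_self (h : IsSVD Y U σ V) :
    Yᴴ * Y = V * realDiagonal 𝔽 (fun i => σ i ^ 2) * Vᴴ := by
  have hU : Uᴴ * U = 1 := h.left_mem
  rw [h.eq, Matrix.conjTranspose_mul, Matrix.conjTranspose_mul, conjTranspose_realDiagonal,
    Matrix.conjTranspose_conjTranspose]
  simp_rw [pow_two, ← realDiagonal_mul]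
  simp only [Matrix.mul_assoc]
  rw [← Matrix.mul_assoc Uᴴ U, hU, Matrix.one_mul]

theorem IsSVD.momentDet_ne_zero_iff (h : IsSVD Y U σ V) :
    momentDet Y ≠ 0 ↔ Function.Injective σ ∧ ∀ i, σ i ≠ 0 := by
  rw [SingularVectors.momentDet_ne_zero_iff (V := ⟨V, h.right_mem⟩) h.conjTranspose_mul_self]
  refine and_congr ⟨fun hi i j hij => hi (by simp [hij]), fun hi i j hij => hi ?_⟩ (by simp)
  exact (pow_left_inj₀ (h.nonneg i) (h.nonneg j) two_ne_zero).mp hij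

/-- Left and right singular vectors are covariant under the unitary groups. -/
theorem IsSVD.unitary_mul (h : IsSVD Y U σ V) (A : UnitaryGroup 𝔽 m) (B : UnitaryGroup 𝔽 n) :
    IsSVD (A.1 * Y * B.1ᴴ) (A.1 * U) σ (B.1 * V) where
  left_mem := (A • (⟨U, h.left_mem⟩ : Stiefel 𝔽 n m)).2
  right_mem := mul_mem B.2 h.right_mem
  nonneg := h.nonneg
  antitone := h.antitone
  eq := by rw [h.eq, Matrix.conjTranspose_mul]; simp only [Matrix.mul_assoc]

/-- Real scalars are central, so the `(i, j)` entry of the relation reads `(d j - d' i) • W i j =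
0`. -/
theorem eq_of_realDiagonal_mul_eq {W : Matrix (Fin n) (Fin n) 𝔽} {d d' : Fin n → ℝ}
    (h : W * realDiagonal 𝔽 d = realDiagonal 𝔽 d' * W) {i j : Fin n} (hW : W i j ≠ 0) :
    d j = d' i := by
  have := congrFun (congrFun h i) j
  rw [realDiagonal, realDiagonal, Matrix.mul_diagonal, Matrix.diagonal_mul, ← Algebra.commutes,
    ← sub_eq_zero, ← sub_mul, ← map_sub, ← Algebra.smul_def] at this
  exact sub_eq_zero.mp ((smul_eq_zero.mp this).resolve_right hW)

theorem IsSVD.intertwine (h : IsSVD Y U σ V) (h' : IsSVD Y U' σ' V') :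
    (V'ᴴ * V) * realDiagonal 𝔽 (fun i => σ i ^ 2)
      = realDiagonal 𝔽 (fun i => σ' i ^ 2) * (V'ᴴ * V) := by
  have hV : Vᴴ * V = 1 := (Unitary.mem_iff.mp h.right_mem).1
  have hV' : V'ᴴ * V' = 1 := (Unitary.mem_iff.mp h'.right_mem).1
  have key := h.conjTranspose_mul_self.symm.trans h'.conjTranspose_mul_self
  calc (V'ᴴ * V) * realDiagonal 𝔽 (fun i => σ i ^ 2)
      = V'ᴴ * (V * realDiagonal 𝔽 (fun i => σ i ^ 2) * Vᴴ) * V := by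
        simp only [Matrix.mul_assoc, hV, Matrix.mul_one]
    _ = realDiagonal 𝔽 (fun i => σ' i ^ 2) * (V'ᴴ * V) := by
        rw [key]
        simp only [Matrix.mul_assoc]
        rw [← Matrix.mul_assoc V'ᴴ V', hV', Matrix.one_mul]

theorem IsSVD.range_subset (h : IsSVD Y U σ V) (h' : IsSVD Y U' σ' V') :
    Set.range σ ⊆ Set.range σ' := by
  rintro _ ⟨j, rfl⟩
  have hnt : Nontrivial 𝔽 := algebraMap_real_injective.nontrivial
  -- A unitary matrix has no zero column.
  obtain ⟨i, hi⟩ : ∃ i, (V'ᴴ * V) i j ≠ 0 := by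
    by_contra! hz
    have hV : Vᴴ * V = 1 := (Unitary.mem_iff.mp h.right_mem).1
    have hV' : V' * V'ᴴ = 1 := (Unitary.mem_iff.mp h'.right_mem).2
    have h1 : (V'ᴴ * V)ᴴ * (V'ᴴ * V) = 1 := by
      rw [Matrix.conjTranspose_mul, Matrix.conjTranspose_conjTranspose, Matrix.mul_assoc,
        ← Matrix.mul_assoc V', hV', Matrix.one_mul, hV]
    have := congrFun (congrFun h1 j) j
    rw [Matrix.mul_apply, Finset.sum_eq_zero fun i _ => by rw [hz, mul_zero]] at this
    simp at this
  have := eq_of_realDiagonal_mul_eq (h.intertwine h') hi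
  exact ⟨i, ((pow_left_inj₀ (h.nonneg j) (h'.nonneg i) two_ne_zero).mp this).symm⟩

theorem IsSVD.singularValues_unique (h : IsSVD Y U σ V) (h' : IsSVD Y U' σ' V')
    (hY : momentDet Y ≠ 0) : σ = σ' :=
  (StrictAnti.range_inj (h.antitone.strictAnti_of_injective (h.momentDet_ne_zero_iff.mp hY).1)
    (h'.antitone.strictAnti_of_injective (h'.momentDet_ne_zero_iff.mp hY).1)).mp
      ((h.range_subset h').antisymm (h'.range_subset h))

/-- `V'ᴴ V` commutes with `diag(σ²)`, whose entries are distinct, so it is diagonal and commutes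
with every `diag(f)`. The choice `f = a` serves the flag, `f = σ⁻¹` the polar factor. -/
theorem IsSVD.conj_realDiagonal_unique (h : IsSVD Y U σ V) (h' : IsSVD Y U' σ' V')
    (hY : momentDet Y ≠ 0) (f : Fin n → ℝ) :
    V * realDiagonal 𝔽 f * Vᴴ = V' * realDiagonal 𝔽 f * V'ᴴ := by
  obtain rfl := h.singularValues_unique h' hY
  have hσ := (h.momentDet_ne_zero_iff.mp hY).1
  have hW : (V'ᴴ * V) * realDiagonal 𝔽 f = realDiagonal 𝔽 f * (V'ᴴ * V) := by
    ext i j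
    rw [realDiagonal, Matrix.mul_diagonal, Matrix.diagonal_mul, ← Algebra.commutes]
    by_cases hz : (V'ᴴ * V) i j = 0
    · rw [hz, mul_zero, mul_zero]
    · obtain rfl : j = i := hσ ((pow_left_inj₀ (h.nonneg _) (h.nonneg _) two_ne_zero).mp
        (eq_of_realDiagonal_mul_eq (h.intertwine h') hz))
      rfl
  have hV : V * Vᴴ = 1 := (Unitary.mem_iff.mp h.right_mem).2
  have hV' : V' * V'ᴴ = 1 := (Unitary.mem_iff.mp h'.right_mem).2
  calc V * realDiagonal 𝔽 f * Vᴴ = V' * ((V'ᴴ * V) * realDiagonal 𝔽 f) * Vᴴ := by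
        simp only [← Matrix.mul_assoc, hV', Matrix.one_mul]
    _ = V' * realDiagonal 𝔽 f * V'ᴴ := by
        rw [hW]; simp only [Matrix.mul_assoc, hV, Matrix.mul_one]

theorem IsSVD.left_mul_conjTranspose (h : IsSVD Y U σ V) (hσ : ∀ i, σ i ≠ 0) :
    U * Vᴴ = Y * (V * realDiagonal 𝔽 (fun i => (σ i)⁻¹) * Vᴴ) := by
  have hV : Vᴴ * V = 1 := (Unitary.mem_iff.mp h.right_mem).1
  rw [h.eq]
  simp only [Matrix.mul_assoc]
  rw [← Matrix.mul_assoc Vᴴ V, hV, Matrix.one_mul, ← Matrix.mul_assoc (realDiagonal 𝔽 σ),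
    realDiagonal_mul]
  simp [hσ, realDiagonal_one]

theorem IsSVD.left_mul_conjTranspose_unique (h : IsSVD Y U σ V) (h' : IsSVD Y U' σ' V')
    (hY : momentDet Y ≠ 0) : U * Vᴴ = U' * V'ᴴ := by
  rw [h.left_mul_conjTranspose (h.momentDet_ne_zero_iff.mp hY).2,
    h'.left_mul_conjTranspose (h'.momentDet_ne_zero_iff.mp hY).2,
    h.singularValues_unique h' hY, h.conj_realDiagonal_unique h' hY]

variable [FiniteDimensional ℝ 𝔽]

theorem exists_antitone_diagonalization {H : Matrix (Fin n) (Fin n) 𝔽} (hH : Hᴴ = H) :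
    ∃ (V : UnitaryGroup 𝔽 n) (d : Fin n → ℝ), Antitone d ∧
      H = V.1 * realDiagonal 𝔽 d * V.1ᴴ := by
  obtain ⟨V, d, hVd⟩ := exists_unitary_diagonalization hH
  let τ := Tuple.sort (fun i => -d i)
  have hV : V.1ᴴ * V.1 = 1 := (Unitary.mem_iff.mp V.2).1
  have h1 : (V.1.submatrix id τ)ᴴ * V.1.submatrix id τ = 1 := by
    rw [Matrix.conjTranspose_submatrix, Matrix.submatrix_mul _ _ τ id τ Function.bijective_id |>.symm,
      hV, Matrix.submatrix_one_equiv]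
  refine ⟨⟨V.1.submatrix id τ, Unitary.mem_iff.mpr ⟨h1, mul_eq_one_comm_matrix h1⟩⟩, d ∘ τ,
    fun i j hij => neg_le_neg_iff.mp (Tuple.monotone_sort (fun i => -d i) hij), ?_⟩
  have h2 : realDiagonal 𝔽 (d ∘ τ) = (realDiagonal 𝔽 d).submatrix τ τ := by
    rw [realDiagonal, realDiagonal, Matrix.submatrix_diagonal_equiv]; rfl
  change H = V.1.submatrix id τ * realDiagonal 𝔽 (d ∘ τ) * (V.1.submatrix id τ)ᴴ
  rw [h2, Matrix.conjTranspose_submatrix, Matrix.submatrix_mul_equiv, Matrix.submatrix_mul_equiv,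
    Matrix.submatrix_id_id, hVd]

/-- Conversely, diagonalizing `Yᴴ Y = V diag(d) Vᴴ` with `d` decreasing gives the SVD with `σ = √d`
and `U = Y V diag(σ)⁻¹`. -/
theorem mem_regular_iff : Y ∈ Regular 𝔽 m n ↔ momentDet Y ≠ 0 := by
  refine ⟨fun ⟨U, σ, V, h, hσ⟩ => h.momentDet_ne_zero_iff.mpr hσ, fun hY => ?_⟩
  obtain ⟨V, d, hd, hVd⟩ := exists_antitone_diagonalization (H := Yᴴ * Y) (by simp)
  obtain ⟨hinj, hd0⟩ := (SingularVectors.momentDet_ne_zero_iff hVd).mp hY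
  have hV : V.1ᴴ * V.1 = 1 := (Unitary.mem_iff.mp V.2).1
  have hV' : V.1 * V.1ᴴ = 1 := (Unitary.mem_iff.mp V.2).2
  have hYV : (Y * V.1)ᴴ * (Y * V.1) = realDiagonal 𝔽 d := by
    rw [Matrix.conjTranspose_mul, Matrix.mul_assoc, ← Matrix.mul_assoc Yᴴ, hVd]
    simp only [Matrix.mul_assoc, hV, Matrix.mul_one]
    rw [← Matrix.mul_assoc, hV, Matrix.one_mul]
  -- `d i` is the sum of squared norms of the entries of column `i` of `Y V`.
  have hdn : ∀ i, 0 ≤ d i := fun i => by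
    have := congrFun (congrFun hYV i) i
    simp only [Matrix.mul_apply (M := (Y * V.1)ᴴ), Matrix.conjTranspose_apply, star_mul_self,
      realDiagonal, Matrix.diagonal_apply_eq, ← map_sum] at this
    rw [← algebraMap_real_injective this]
    positivity
  have hdp : ∀ i, 0 < d i := fun i => (hdn i).lt_of_ne (hd0 i).symm
  refine ⟨Y * V.1 * realDiagonal 𝔽 (fun i => (√(d i))⁻¹), fun i => √(d i), V.1,
    ⟨?_, V.2, fun i => Real.sqrt_nonneg _, fun i j hij => Real.sqrt_le_sqrt (hd hij), ?_⟩,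
    fun i j hij => hinj ((Real.sqrt_inj (hdn i) (hdn j)).mp hij), fun i =>
      (Real.sqrt_pos.mpr (hdp i)).ne'⟩
  · rw [Stiefel, Set.mem_ofPred_eq, Matrix.conjTranspose_mul, conjTranspose_realDiagonal, Matrix.mul_assoc,
      ← Matrix.mul_assoc _ (Y * V.1), hYV, realDiagonal_mul, realDiagonal_mul, ← realDiagonal_one]
    congr 1
    ext i
    have h1 := Real.mul_self_sqrt (hdn i)
    have h2 := (Real.sqrt_pos.mpr (hdp i)).ne'
    field_simp
    linarith
  · rw [Matrix.mul_assoc _ _ (realDiagonal 𝔽 _), realDiagonal_mul]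
    simp [(Real.sqrt_pos.mpr (hdp _)).ne', realDiagonal_one, Matrix.mul_assoc, hV']

variable {a : Fin n → ℝ}

variable (𝔽 m a) in
theorem existsUnique_isSingularVectorsMap :
    ∃! ξ : Regular 𝔽 m n → Stiefel 𝔽 n m × CompleteFlag 𝔽 a, IsSingularVectorsMap a ξ := by
  choose U σ V h using fun Y : Regular 𝔽 m n => Y.2
  refine ⟨fun Y => (⟨U Y * (V Y)ᴴ, ?_⟩, ⟨V Y * realDiagonal 𝔽 a * (V Y)ᴴ,
    ⟨V Y, (h Y).1.right_mem⟩, rfl⟩), fun Y U' σ' V' h' => ?_, fun ξ hξ => ?_⟩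
  · have hU : (U Y)ᴴ * U Y = 1 := (h Y).1.left_mem
    have hV : V Y * (V Y)ᴴ = 1 := (Unitary.mem_iff.mp (h Y).1.right_mem).2
    rw [Stiefel, Set.mem_ofPred_eq, Matrix.conjTranspose_mul, Matrix.mul_assoc, ← Matrix.mul_assoc _ (U Y), hU, Matrix.one_mul,
      Matrix.conjTranspose_conjTranspose, hV]
  · have hY := mem_regular_iff.mp Y.2
    exact ⟨(h Y).1.left_mul_conjTranspose_unique h' hY, (h Y).1.conj_realDiagonal_unique h' hY a⟩
  · funext Y
    obtain ⟨h1, h2⟩ := hξ Y _ _ _ (h Y).1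
    exact Prod.ext (Subtype.ext h1) (Subtype.ext h2)

theorem exists_mem_regular (hnm : n ≤ m) : ∃ Y, Y ∈ Regular 𝔽 m n := by
  let X : Matrix (Fin m) (Fin n) 𝔽 := Matrix.of fun i j => if i = Fin.castLE hnm j then 1 else 0
  -- The values `n, n - 1, …, 1`: decreasing, distinct and positive.
  let d : Fin n → ℝ := fun i => n - i
  have hd : ∀ i, 0 < d i := fun i => by
    have : (i : ℝ) < n := by exact_mod_cast i.2
    simp only [d]; linarith
  refine ⟨X * realDiagonal 𝔽 d * 1ᴴ, X, d, 1, ⟨?_, one_mem _, fun i => (hd i).le,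
    fun i j hij => ?_, rfl⟩, fun i j hij => ?_, fun i => (hd i).ne'⟩
  · change Xᴴ * X = 1
    ext i j
    obtain rfl | hij := eq_or_ne i j
    · simp [Matrix.mul_apply, X]
    · simp [Matrix.mul_apply, X, hij, hij.symm]
  · have : (i : ℝ) ≤ j := by exact_mod_cast hij
    simp only [d]; linarith
  · have : (i : ℝ) = j := by simp only [d] at hij; linarith
    exact Fin.ext (by exact_mod_cast this)

theorem IsSingularVectorsMap.unitary_mul
    {ξ : Regular 𝔽 m n → Stiefel 𝔽 n m × CompleteFlag 𝔽 a} (hξ : IsSingularVectorsMap a ξ)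
    (A : UnitaryGroup 𝔽 m) (B : UnitaryGroup 𝔽 n) (Y : Regular 𝔽 m n) :
    ∃ h : A.1 * Y.1 * B.1ᴴ ∈ Regular 𝔽 m n,
      (ξ ⟨_, h⟩).1.1 = A.1 * (ξ Y).1.1 * B.1ᴴ ∧ (ξ ⟨_, h⟩).2 = B • (ξ Y).2 := by
  obtain ⟨U, σ, V, h, hσ⟩ := Y.2
  have h' := h.unitary_mul A B
  refine ⟨⟨_, _, _, h', hσ⟩, ?_⟩
  obtain ⟨h1, h2⟩ := hξ Y _ _ _ h
  obtain ⟨h3, h4⟩ := hξ ⟨_, ⟨_, _, _, h', hσ⟩⟩ _ _ _ h'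
  refine ⟨by rw [h3, h1, Matrix.conjTranspose_mul]; simp only [Matrix.mul_assoc], Subtype.ext ?_⟩
  change _ = B.1 * (ξ Y).2.1 * B.1ᴴ
  rw [h4, h2, Matrix.conjTranspose_mul]
  simp only [Matrix.mul_assoc]

end SVD

/-! ### Zero sets of analytic functions -/

section Null

/-- A function that is analytic along all lines and nonzero somewhere is nonzero almost
everywhere. -/
theorem ae_ne_zero_of_analytic_on_lines {E : Type*} [NormedAddCommGroup E] [NormedSpace ℝ E]
    [FiniteDimensional ℝ E] [MeasurableSpace E] [BorelSpace E] (μ : Measure E)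
    [μ.IsAddHaarMeasure] {f : E → ℝ} (hc : Continuous f)
    (hf : ∀ x y, AnalyticOnNhd ℝ (fun t : ℝ => f (x + t • y)) Set.univ) {x₀ : E}
    (hx₀ : f x₀ ≠ 0) : ∀ᵐ x ∂μ, f x ≠ 0 := by
  -- On each line through `x₀` the function is nonzero at `t = 0`, so its zeros are isolated. Fubini
  -- then provides one `t ≠ 0` that is good for almost all `y`, and scaling and translation remove
  -- `t` and `x₀`.
  have h1 : ∀ᵐ y ∂μ, ∀ᵐ t : ℝ, f (x₀ + t • y) ≠ 0 := by
    refine Filter.Eventually.of_forall fun y => ?_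
    have h := (hf x₀ y).preimage_zero_mem_codiscrete (x := 0) (by simpa using hx₀)
    have := ae_restrict_le_codiscreteWithin (μ := volume) (U := (Set.univ : Set ℝ))
      MeasurableSet.univ h
    rw [Measure.restrict_univ] at this
    exact this
  have hm : MeasurableSet {p : E × ℝ | f (x₀ + p.2 • p.1) ≠ 0} :=
    (isOpen_ne.preimage (by fun_prop : Continuous fun p : E × ℝ => f (x₀ + p.2 • p.1))).measurableSet
  rw [Measure.ae_ae_comm hm] at h1
  have h0 : ∀ᵐ t : ℝ, t ≠ 0 := by simp [ae_iff]
  obtain ⟨t, ht, ht0⟩ := (h1.and h0).exists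
  have h2 : μ ((t • ·) ⁻¹' {z | f (x₀ + z) = 0}) = 0 := by
    simpa [ae_iff] using ht
  rw [Measure.addHaar_preimage_smul μ ht0, mul_eq_zero] at h2
  have h3 := h2.resolve_left (by simp [ht0])
  have h4 : {z | f (x₀ + z) = 0} = (x₀ + ·) ⁻¹' {z | f z = 0} := rfl
  rw [h4, measure_preimage_add] at h3
  simpa [ae_iff] using h3

end Null

/-! ### Compactness of the manifolds and continuity of `ξ` -/

section Topology

variable {𝔽 : Type*} [NormedRing 𝔽] [StarRing 𝔽] [NormedAlgebra ℝ 𝔽] [HermitianScalars 𝔽]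
variable [StarModule ℝ 𝔽] [FiniteDimensional ℝ 𝔽] [ContinuousStar 𝔽] {k m n : ℕ}

theorem continuous_re : Continuous (re : 𝔽 →ₗ[ℝ] ℝ) := LinearMap.continuous_of_finiteDimensional _

theorem continuous_reTrace : Continuous (reTrace : Matrix (Fin n) (Fin n) 𝔽 → ℝ) :=
  continuous_re.comp continuous_id.matrix_trace

theorem continuous_momentDet : Continuous (momentDet : Matrix (Fin m) (Fin n) 𝔽 → ℝ) := by
  refine Continuous.matrix_det (continuous_matrix fun i j => ?_)
  exact continuous_reTrace.comp
    ((continuous_id.matrix_conjTranspose.matrix_mul continuous_id).pow _)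

theorem analyticOnNhd_momentDet_line (X W : Matrix (Fin m) (Fin n) 𝔽) :
    AnalyticOnNhd ℝ (fun t : ℝ => momentDet (X + t • W)) Set.univ := by
  have hmul : ∀ {p q r : ℕ} {M : ℝ → Matrix (Fin p) (Fin q) 𝔽} {N : ℝ → Matrix (Fin q) (Fin r) 𝔽},
      (∀ i j, AnalyticOnNhd ℝ (fun t => M t i j) Set.univ) →
      (∀ i j, AnalyticOnNhd ℝ (fun t => N t i j) Set.univ) →
      ∀ i j, AnalyticOnNhd ℝ (fun t => (M t * N t) i j) Set.univ := fun hM hN i j => by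
    simp only [Matrix.mul_apply]
    exact Finset.analyticOnNhd_fun_sum _ fun l _ => (hM i l).mul (hN l j)
  have hX : ∀ i j, AnalyticOnNhd ℝ (fun t : ℝ => (X + t • W) i j) Set.univ := fun i j => by
    simp only [Matrix.add_apply, Matrix.smul_apply]
    exact analyticOnNhd_const.add (analyticOnNhd_id.smul analyticOnNhd_const)
  -- The star is real linear, so the conjugate transpose is again affine in `t`.
  have hX' : ∀ i j, AnalyticOnNhd ℝ (fun t : ℝ => (X + t • W)ᴴ i j) Set.univ := fun i j => by
    simp only [Matrix.conjTranspose_apply, Matrix.add_apply, Matrix.smul_apply, star_add,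
      star_smul, star_trivial]
    exact analyticOnNhd_const.add (analyticOnNhd_id.smul analyticOnNhd_const)
  have hpow : ∀ (k : ℕ) i j,
      AnalyticOnNhd ℝ (fun t : ℝ => (((X + t • W)ᴴ * (X + t • W)) ^ k) i j) Set.univ := fun k => by
    induction k with
    | zero => intro i j; simp only [pow_zero]; exact analyticOnNhd_const
    | succ k ih => simp only [pow_succ]; exact hmul ih (hmul hX' hX)
  simp only [momentDet, Matrix.det_apply, Matrix.of_apply, reTrace, Matrix.trace, Matrix.diag]
  refine Finset.analyticOnNhd_fun_sum _ fun τ _ => ?_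
  simp only [Units.smul_def, zsmul_eq_mul]
  refine analyticOnNhd_const.mul (Finset.analyticOnNhd_fun_prod _ fun i _ => ?_)
  simp only [map_sum]
  refine Finset.analyticOnNhd_fun_sum _ fun l _ => ?_
  exact (LinearMap.toContinuousLinearMap (re : 𝔽 →ₗ[ℝ] ℝ)).analyticOnNhd _ |>.comp (hpow _ l l)
    (Set.mapsTo_univ _ _)

theorem isCompact_stiefel : IsCompact (Stiefel 𝔽 k m) := by
  have hK : IsCompact (Set.univ.pi fun _ : Fin m => Set.univ.pi fun _ : Fin k =>
      Metric.closedBall (0 : 𝔽) 1) :=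
    isCompact_univ_pi fun _ => isCompact_univ_pi fun _ => isCompact_closedBall _ _
  refine hK.of_isClosed_subset ?_ fun (X : Matrix (Fin m) (Fin k) 𝔽) hX i _ j _ => ?_
  · exact isClosed_eq (continuous_id.matrix_conjTranspose.matrix_mul continuous_id)
      continuous_const
  · have hX' : Xᴴ * X = 1 := hX
    have h1 := congrArg (re : 𝔽 →ₗ[ℝ] ℝ) (congrFun (congrFun hX' j) j)
    simp only [Matrix.mul_apply, Matrix.conjTranspose_apply, map_sum, re_star_mul_self,
      Matrix.one_apply_eq, re_one] at h1
    have h2 := Finset.single_le_sum (f := fun i => ‖X i j‖ ^ 2) (fun i _ => by positivity)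
      (Finset.mem_univ i)
    rw [h1] at h2
    rw [mem_closedBall_zero_iff]
    exact (sq_le_one_iff₀ (norm_nonneg _)).mp h2

instance : CompactSpace (Stiefel 𝔽 k m) := isCompact_iff_compactSpace.mp isCompact_stiefel

instance : CompactSpace (UnitaryGroup 𝔽 n) := by
  refine isCompact_iff_compactSpace.mp
    ((isCompact_stiefel (𝔽 := 𝔽) (k := n) (m := n)).of_isClosed_subset ?_
      fun Q hQ => (Unitary.mem_iff.mp hQ).1)
  have : ((unitary (Matrix (Fin n) (Fin n) 𝔽) : Set (Matrix (Fin n) (Fin n) 𝔽)))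
      = {Q | Qᴴ * Q = 1} := by
    ext Q
    exact ⟨fun h => (Unitary.mem_iff.mp h).1,
      fun h => Unitary.mem_iff.mpr ⟨h, mul_eq_one_comm_matrix h⟩⟩
  change IsClosed ((unitary (Matrix (Fin n) (Fin n) 𝔽) : Set (Matrix (Fin n) (Fin n) 𝔽)))
  rw [this]
  exact isClosed_eq (continuous_id.matrix_conjTranspose.matrix_mul continuous_id) continuous_const

/-- This makes `σ` a continuous function of `(Y, U, V)`, so that being an SVD is a closed condition
on these three matrices. -/
theorem IsSVD.eq_re {Y U : Matrix (Fin m) (Fin n) 𝔽} {σ : Fin n → ℝ}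
    {V : Matrix (Fin n) (Fin n) 𝔽} (h : IsSVD Y U σ V) : σ = fun i => re ((Uᴴ * Y * V) i i) := by
  have hU : Uᴴ * U = 1 := h.left_mem
  have hV : Vᴴ * V = 1 := (Unitary.mem_iff.mp h.right_mem).1
  have : Uᴴ * Y * V = realDiagonal 𝔽 σ := by
    rw [h.eq]
    simp only [← Matrix.mul_assoc, hU, Matrix.one_mul]
    rw [Matrix.mul_assoc, hV, Matrix.mul_one]
  funext i
  rw [this]
  simp [realDiagonal]

/-- The map `(U, V) ↦ (U Vᴴ, V diag(a) Vᴴ)`. -/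
def polarFlag (𝔽 : Type*) [Ring 𝔽] [StarRing 𝔽] [Algebra ℝ 𝔽] {n : ℕ} (m : ℕ) (a : Fin n → ℝ)
    (p : Stiefel 𝔽 n m × UnitaryGroup 𝔽 n) : Stiefel 𝔽 n m × CompleteFlag 𝔽 a :=
  (⟨p.1.1 * p.2.1ᴴ, by
    have hU : p.1.1ᴴ * p.1.1 = 1 := p.1.2
    have hV : p.2.1 * p.2.1ᴴ = 1 := (Unitary.mem_iff.mp p.2.2).2
    change (p.1.1 * p.2.1ᴴ)ᴴ * (p.1.1 * p.2.1ᴴ) = 1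
    rw [Matrix.conjTranspose_mul, Matrix.mul_assoc,
      ← Matrix.mul_assoc _ p.1.1, hU, Matrix.one_mul, Matrix.conjTranspose_conjTranspose, hV]⟩,
    ⟨p.2.1 * realDiagonal 𝔽 a * p.2.1ᴴ, p.2, rfl⟩)

theorem continuous_polarFlag (a : Fin n → ℝ) : Continuous (polarFlag 𝔽 m a) := by
  refine Continuous.prodMk (Continuous.subtype_mk ?_ _) (Continuous.subtype_mk ?_ _)
  · exact Continuous.matrix_mul (by fun_prop) (Continuous.matrix_conjTranspose (by fun_prop))
  · exact Continuous.matrix_mul (Continuous.matrix_mul (by fun_prop) continuous_const)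
      (Continuous.matrix_conjTranspose (by fun_prop))

theorem continuous_realDiagonal :
    Continuous (realDiagonal 𝔽 : (Fin n → ℝ) → Matrix (Fin n) (Fin n) 𝔽) :=
  Continuous.matrix_diagonal (continuous_pi fun i =>
    (continuous_algebraMap ℝ 𝔽).comp (continuous_apply i))

/-- No continuous choice of `(U, V)` is needed: the preimage of a closed set is the projection of a
closed set of triples `(Y, U, V)` along a compact factor, hence closed. -/
theorem IsSingularVectorsMap.continuous {a : Fin n → ℝ}
    {ξ : Regular 𝔽 m n → Stiefel 𝔽 n m × CompleteFlag 𝔽 a} (hξ : IsSingularVectorsMap a ξ) :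
    Continuous ξ := by
  let s : Regular 𝔽 m n × (Stiefel 𝔽 n m × UnitaryGroup 𝔽 n) → Fin n → ℝ :=
    fun p i => re ((p.2.1.1ᴴ * p.1.1 * p.2.2.1) i i)
  have hs : Continuous s := continuous_pi fun i => continuous_re.comp
    (Continuous.matrix_elem (Continuous.matrix_mul (Continuous.matrix_mul
      (Continuous.matrix_conjTranspose (by fun_prop)) (by fun_prop)) (by fun_prop)) i i)
  let S : Set (Regular 𝔽 m n × (Stiefel 𝔽 n m × UnitaryGroup 𝔽 n)) :=
    {p | (∀ i, 0 ≤ s p i) ∧ (∀ i j, i ≤ j → s p j ≤ s p i) ∧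
      p.1.1 = p.2.1.1 * realDiagonal 𝔽 (s p) * p.2.2.1ᴴ}
  have hS : IsClosed S := by
    simp only [S, Set.ofPred_and, Set.ofPred_forall]
    refine IsClosed.inter (isClosed_iInter fun i => ?_) (IsClosed.inter
      (isClosed_iInter fun i => isClosed_iInter fun j => isClosed_iInter fun _ => ?_) ?_)
    · exact isClosed_le continuous_const ((continuous_apply i).comp hs)
    · exact isClosed_le ((continuous_apply j).comp hs) ((continuous_apply i).comp hs)
    · exact isClosed_eq (by fun_prop) (Continuous.matrix_mul (Continuous.matrix_mul (by fun_prop)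
        (continuous_realDiagonal.comp hs)) (Continuous.matrix_conjTranspose (by fun_prop)))
  refine continuous_iff_isClosed.mpr fun C hC => ?_
  have : ξ ⁻¹' C = Prod.fst '' (S ∩ Prod.snd ⁻¹' (polarFlag 𝔽 m a ⁻¹' C)) := by
    ext Y
    constructor
    · intro hY
      obtain ⟨U, σ, V, h, -⟩ := Y.2
      have hσ : s (Y, ⟨U, h.left_mem⟩, ⟨V, h.right_mem⟩) = σ := h.eq_re.symm
      refine ⟨(Y, ⟨U, h.left_mem⟩, ⟨V, h.right_mem⟩), ⟨⟨fun i => ?_, fun i j hij => ?_, ?_⟩, ?_⟩,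
        rfl⟩
      · rw [hσ]; exact h.nonneg i
      · rw [hσ]; exact h.antitone hij
      · rw [hσ]; exact h.eq
      · obtain ⟨h1, h2⟩ := hξ Y _ _ _ h
        have : polarFlag 𝔽 m a (⟨U, h.left_mem⟩, ⟨V, h.right_mem⟩) = ξ Y :=
          Prod.ext (Subtype.ext h1.symm) (Subtype.ext h2.symm)
        change polarFlag 𝔽 m a _ ∈ C
        rw [this]
        exact hY
    · rintro ⟨⟨Y', U, V⟩, ⟨⟨h1, h2, h3⟩, h4⟩, rfl⟩
      obtain ⟨h5, h6⟩ := hξ Y' U.1 _ V.1 ⟨U.2, V.2, h1, fun i j hij => h2 i j hij, h3⟩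
      have : polarFlag 𝔽 m a (U, V) = ξ Y' :=
        Prod.ext (Subtype.ext h5.symm) (Subtype.ext h6.symm)
      change ξ Y' ∈ C
      rw [← this]
      exact h4
  rw [this]
  exact isClosedMap_fst_of_compactSpace _ (hS.inter (((hC.preimage (continuous_polarFlag a))).preimage
    continuous_snd))

end Topology

/-! ### Borel structure on matrices -/

section BorelMatrix

variable {𝔽 : Type*} [NormedRing 𝔽] [NormedAlgebra ℝ 𝔽] [FiniteDimensional ℝ 𝔽]
variable {m n : ℕ}

theorem secondCountable_of_finiteDimensional : SecondCountableTopology 𝔽 := by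
  have : ProperSpace 𝔽 := FiniteDimensional.proper ℝ 𝔽
  infer_instance

instance [MeasurableSpace 𝔽] [BorelSpace 𝔽] : BorelSpace (Matrix (Fin m) (Fin n) 𝔽) := by
  have : SecondCountableTopology 𝔽 := secondCountable_of_finiteDimensional
  exact inferInstanceAs (BorelSpace (Fin m → Fin n → 𝔽))

instance : SecondCountableTopology (Matrix (Fin m) (Fin n) 𝔽) := by
  have : SecondCountableTopology 𝔽 := secondCountable_of_finiteDimensional
  exact inferInstanceAs (SecondCountableTopology (Fin m → Fin n → 𝔽))

end BorelMatrix

/-! ### Invariance and total mass of the Ginibre measure -/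

section Lebesgue

variable {𝔽 : Type*} [NormedRing 𝔽] [NormedAlgebra ℝ 𝔽] [FiniteDimensional ℝ 𝔽]
variable [MeasureSpace 𝔽] [BorelSpace 𝔽] [(volume : Measure 𝔽).IsAddHaarMeasure] {m n : ℕ}

/-- `lebesgue` as a Haar measure on the normed space of functions. -/
theorem isAddHaarMeasure_lebesgue :
    Measure.IsAddHaarMeasure (G := Fin m → Fin n → 𝔽) (lebesgue 𝔽 m n) := by
  have : SecondCountableTopology 𝔽 := secondCountable_of_finiteDimensional
  have : ProperSpace 𝔽 := FiniteDimensional.proper ℝ 𝔽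
  have h : (Measure.pi fun _ : Fin n => (volume : Measure 𝔽)).IsAddHaarMeasure :=
    Measure.pi.isAddHaarMeasure _
  exact Measure.pi.isAddHaarMeasure fun _ : Fin m => Measure.pi fun _ : Fin n => (volume : Measure 𝔽)

theorem exists_map_lebesgue_eq_smul
    (L : Matrix (Fin m) (Fin n) 𝔽 ≃ₗ[ℝ] Matrix (Fin m) (Fin n) 𝔽) :
    ∃ c : ENNReal, (lebesgue 𝔽 m n).map L = c • lebesgue 𝔽 m n := by
  let μ : Measure (Fin m → Fin n → 𝔽) := lebesgue 𝔽 m n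
  have : μ.IsAddHaarMeasure := isAddHaarMeasure_lebesgue
  have : SecondCountableTopology 𝔽 := secondCountable_of_finiteDimensional
  let L' : (Fin m → Fin n → 𝔽) ≃ₗ[ℝ] (Fin m → Fin n → 𝔽) := L
  exact ⟨_, Measure.map_linearMap_addHaar_eq_smul_addHaar
    (f := (L' : (Fin m → Fin n → 𝔽) →ₗ[ℝ] (Fin m → Fin n → 𝔽))) μ
    (LinearEquiv.isUnit_det' L').ne_zero⟩

theorem measurable_frobeniusSq :
    Measurable (frobeniusSq : Matrix (Fin m) (Fin n) 𝔽 → ℝ) := by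
  refine Continuous.measurable ?_
  unfold frobeniusSq
  refine continuous_finsetSum _ fun i _ => continuous_finsetSum _ fun j _ => ?_
  exact (Continuous.norm (continuous_id.matrix_elem i j)).pow 2

theorem map_ginibre {β : ℝ} [IsProbabilityMeasure (ginibre 𝔽 β m n)]
    (L : Matrix (Fin m) (Fin n) 𝔽 ≃ₗ[ℝ] Matrix (Fin m) (Fin n) 𝔽)
    (hL : ∀ Y, frobeniusSq (L Y) = frobeniusSq Y) :
    (ginibre 𝔽 β m n).map L = ginibre 𝔽 β m n := by
  have hLc : Continuous L := by
    let L' : (Fin m → Fin n → 𝔽) ≃ₗ[ℝ] (Fin m → Fin n → 𝔽) := L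
    exact L'.toLinearMap.continuous_of_finiteDimensional
  have hLm : Measurable L := hLc.measurable
  obtain ⟨c, hc⟩ := exists_map_lebesgue_eq_smul L
  have hd : Measurable fun Y : Matrix (Fin m) (Fin n) 𝔽 => ENNReal.ofReal
      ((β / (2 * Real.pi)) ^ ((m : ℝ) * n * β / 2) * Real.exp (-(β / 2 * frobeniusSq Y))) :=
    (((measurable_frobeniusSq.const_mul _).neg.exp).const_mul _).ennreal_ofReal
  have key : (ginibre 𝔽 β m n).map L = c • ginibre 𝔽 β m n := by
    rw [ginibre, ← withDensity_smul_measure, ← hc]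
    ext s hs
    rw [Measure.map_apply hLm hs, withDensity_apply _ (hLm hs), withDensity_apply _ hs,
      setLIntegral_map hs hd hLm]
    simp only [hL]
  -- The Jacobian constant `c` needs no computation: both sides have total mass one.
  have h1 : c = 1 := by
    have := congrArg (fun μ => μ Set.univ) key
    simpa [Measure.map_apply hLm MeasurableSet.univ] using this.symm
  rw [key, h1, one_smul]

theorem isProbabilityMeasure_ginibre {β : ℝ} (hβ : 0 < β)
    (hI : ∫ x : 𝔽, Real.exp (-(β / 2) * ‖x‖ ^ 2) = (2 * Real.pi / β) ^ (β / 2)) :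
    IsProbabilityMeasure (ginibre 𝔽 β m n) := by
  have : SecondCountableTopology 𝔽 := secondCountable_of_finiteDimensional
  have : ProperSpace 𝔽 := FiniteDimensional.proper ℝ 𝔽
  have hpi : (0 : ℝ) < 2 * Real.pi / β := by have := Real.pi_pos; positivity
  have h1 : ∫ Y, Real.exp (-(β / 2 * frobeniusSq Y)) ∂(lebesgue 𝔽 m n)
      = (2 * Real.pi / β) ^ ((m : ℝ) * n * β / 2) := by
    -- The density factors over the entries, which reduces the integral to `m n` copies of `hI`.
    have h2 : ∀ Y : Matrix (Fin m) (Fin n) 𝔽, Real.exp (-(β / 2 * frobeniusSq Y))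
        = ∏ i, ∏ j, Real.exp (-(β / 2) * ‖Y i j‖ ^ 2) := fun Y => by
      simp only [frobeniusSq, ← Real.exp_sum, ← Finset.mul_sum, neg_mul, Finset.sum_neg_distrib]
    simp only [h2, lebesgue]
    refine (integral_fintype_prod_eq_prod (E := fun _ : Fin m => Fin n → 𝔽)
      (fun _ y => ∏ j, Real.exp (-(β / 2) * ‖y j‖ ^ 2))).trans ?_
    simp only [integral_fintype_prod_eq_prod (E := fun _ : Fin n => 𝔽)
      (fun _ x => Real.exp (-(β / 2) * ‖x‖ ^ 2)), hI, Finset.prod_const, Finset.card_univ,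
      Fintype.card_fin]
    rw [← Real.rpow_natCast, ← Real.rpow_natCast, ← Real.rpow_mul hpi.le, ← Real.rpow_mul hpi.le]
    ring_nf
  have hint : Integrable (fun Y => Real.exp (-(β / 2 * frobeniusSq Y))) (lebesgue 𝔽 m n) :=
    Integrable.of_integral_ne_zero (by rw [h1]; positivity)
  constructor
  rw [ginibre, withDensity_apply _ MeasurableSet.univ, Measure.restrict_univ,
    ← ofReal_integral_eq_lintegral_ofReal (hint.const_mul _)
      (Filter.Eventually.of_forall fun Y => by positivity), integral_const_mul, h1,
    ← Real.mul_rpow (by positivity) hpi.le]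
  have : β / (2 * Real.pi) * (2 * Real.pi / β) = 1 := by
    have := Real.pi_pos.ne'
    field_simp
  rw [this, Real.one_rpow, ENNReal.ofReal_one]

end Lebesgue

/-! ### Almost sure regularity -/

section Regular

variable {𝔽 : Type*} [NormedRing 𝔽] [StarRing 𝔽] [NormedAlgebra ℝ 𝔽] [HermitianScalars 𝔽]
variable [StarModule ℝ 𝔽] [FiniteDimensional ℝ 𝔽] [ContinuousStar 𝔽]
variable [MeasureSpace 𝔽] [BorelSpace 𝔽] {m n : ℕ}

theorem measurableSet_regular : MeasurableSet (Regular 𝔽 m n) := by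
  have : Regular 𝔽 m n = {Y | momentDet Y ≠ 0} := Set.ext fun _ => mem_regular_iff
  rw [this]
  exact (isOpen_ne.preimage continuous_momentDet).measurableSet

theorem ae_mem_regular [(volume : Measure 𝔽).IsAddHaarMeasure] (hnm : n ≤ m) (β : ℝ) :
    ∀ᵐ Y ∂(ginibre 𝔽 β m n), Y ∈ Regular 𝔽 m n := by
  have : SecondCountableTopology 𝔽 := secondCountable_of_finiteDimensional
  refine (withDensity_absolutelyContinuous _ _).ae_le ?_
  obtain ⟨Y₀, hY₀⟩ := exists_mem_regular (𝔽 := 𝔽) hnm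
  simp only [mem_regular_iff] at hY₀ ⊢
  let μ : Measure (Fin m → Fin n → 𝔽) := lebesgue 𝔽 m n
  have : μ.IsAddHaarMeasure := isAddHaarMeasure_lebesgue
  exact ae_ne_zero_of_analytic_on_lines (E := Fin m → Fin n → 𝔽) μ (f := momentDet)
    continuous_momentDet analyticOnNhd_momentDet_line hY₀

end Regular

/-! ### Invariant measures on homogeneous spaces -/

section Homogeneous

variable {G X W : Type*} [Group G] [MeasurableSpace G] [MeasurableMul G] [MeasurableSpace X]
variable [MeasurableSpace W] [MulAction G X]

theorem measurable_const_smul_of_measurable_smul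
    (hact : Measurable fun p : G × X => p.1 • p.2) (g : G) : Measurable fun x : X => g • x :=
  hact.comp (measurable_const.prodMk measurable_id)

/-- A measure on `X × W` that is invariant under a transitive action of a compact group on `X` is
the product of the orbit law and the second marginal. -/
theorem eq_prod_of_transitive (hact : Measurable fun p : G × X => p.1 • p.2) {x₀ : X}
    (htrans : ∀ x : X, ∃ g : G, g • x₀ = x) (h : Measure G) [IsProbabilityMeasure h]
    [h.IsMulRightInvariant] (μ : Measure (X × W)) [IsProbabilityMeasure μ]
    (hμ : ∀ g : G, μ.map (fun p => (g • p.1, p.2)) = μ) :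
    μ = (h.map (· • x₀)).prod (μ.map Prod.snd) := by
  have hx₀ : Measurable fun g : G => g • x₀ := hact.comp (measurable_id.prodMk measurable_const)
  have : IsProbabilityMeasure (h.map (· • x₀)) := Measure.isProbabilityMeasure_map hx₀.aemeasurable
  have : IsProbabilityMeasure (μ.map Prod.snd) :=
    Measure.isProbabilityMeasure_map measurable_snd.aemeasurable
  symm
  refine Measure.prod_eq fun s t hs ht => ?_
  -- The measure of `N` under `h ⊗ μ` is computed in both orders. For fixed `g`, invariance of `μ`
  -- gives `μ (s ×ˢ t)`. For fixed `(k • x₀, w)`, right invariance of `h` absorbs `k` and leaves the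
  -- orbit law of `s`.
  let N : Set (G × (X × W)) := {q | q.1 • q.2.1 ∈ s ∧ q.2.2 ∈ t}
  have hN : MeasurableSet N := by
    have h1 : Measurable fun q : G × (X × W) => q.1 • q.2.1 :=
      hact.comp (measurable_fst.prodMk (measurable_fst.comp measurable_snd))
    exact (h1 hs).inter ((measurable_snd.comp measurable_snd) ht)
  have h1 : (h.prod μ) N = μ (s ×ˢ t) := by
    rw [Measure.prod_apply hN]
    have : ∀ g : G, μ (Prod.mk g ⁻¹' N) = μ (s ×ˢ t) := fun g => by
      have hm : Measurable fun p : X × W => (g • p.1, p.2) :=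
        (hact.comp (measurable_const.prodMk measurable_fst)).prodMk measurable_snd
      conv_rhs => rw [← hμ g, Measure.map_apply hm (hs.prod ht)]
      rfl
    simp [this]
  have h2 : (h.prod μ) N = (h.map (· • x₀)) s * (μ.map Prod.snd) t := by
    rw [Measure.prod_apply_symm hN]
    have : ∀ p : X × W, h ((fun g => (g, p)) ⁻¹' N)
        = (Prod.snd ⁻¹' t).indicator (fun _ => (h.map (· • x₀)) s) p := fun p => by
      obtain ⟨k, hk⟩ := htrans p.1
      by_cases hp : p.2 ∈ t
      · rw [Set.indicator_of_mem (by exact hp), Measure.map_apply hx₀ hs]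
        refine Eq.trans ?_ (measure_preimage_mul_right h k _)
        congr 1
        ext g
        simp [N, hp, ← hk, mul_smul]
      · rw [Set.indicator_of_notMem (by exact hp)]
        simp [N, hp]
    simp only [this]
    rw [lintegral_indicator (measurable_snd ht), setLIntegral_const,
      Measure.map_apply measurable_snd ht]
  exact h1.symm.trans h2

/-- The preceding lemma with a one-point second factor. -/
theorem eq_map_of_transitive (hact : Measurable fun p : G × X => p.1 • p.2) {x₀ : X}
    (htrans : ∀ x : X, ∃ g : G, g • x₀ = x) (h : Measure G) [IsProbabilityMeasure h]
    [h.IsMulRightInvariant] (μ : Measure X) [IsProbabilityMeasure μ]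
    (hμ : ∀ g : G, μ.map (g • ·) = μ) : μ = h.map (· • x₀) := by
  have hi : Measurable fun x : X => (x, ()) := by fun_prop
  have hx₀ : Measurable fun g : G => g • x₀ := hact.comp (measurable_id.prodMk measurable_const)
  have hg : ∀ g : G, Measurable fun x : X => g • x :=
    measurable_const_smul_of_measurable_smul hact
  have : IsProbabilityMeasure (μ.map fun x => (x, ())) :=
    Measure.isProbabilityMeasure_map hi.aemeasurable
  have key := eq_prod_of_transitive hact htrans h (μ.map fun x => (x, ())) fun g => by
    have hm : Measurable fun p : X × Unit => (g • p.1, p.2) :=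
      ((hg g).comp measurable_fst).prodMk measurable_snd
    rw [Measure.map_map hm hi]
    conv_rhs => rw [← hμ g, Measure.map_map hi (hg g)]
    rfl
  have key' := congrArg (Measure.map Prod.fst) key
  have : IsProbabilityMeasure ((μ.map fun x => (x, ())).map Prod.snd) :=
    Measure.isProbabilityMeasure_map measurable_snd.aemeasurable
  rw [Measure.map_map measurable_fst hi, Measure.map_fst_prod, measure_univ, one_smul] at key'
  simpa [Function.comp_def] using key'

variable {G' : Type*} [Group G'] [MeasurableSpace G'] [MeasurableMul G'] [MulAction G' W]

/-- `G'`-invariance is asked of the second marginal only: this is what the equivariance of `ξ`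
supplies directly, since `B` also moves the Stiefel component. Joint invariance follows from the
product structure. -/
theorem isUniform_prod [MulAction (G × G') (X × W)]
    (hsmul : ∀ (g : G × G') (p : X × W), g • p = (g.1 • p.1, g.2 • p.2))
    (hact : Measurable fun p : G × X => p.1 • p.2) {x₀ : X}
    (htrans : ∀ x : X, ∃ g : G, g • x₀ = x) (h : Measure G) [IsProbabilityMeasure h]
    [h.IsMulRightInvariant]
    (hact' : Measurable fun p : G' × W => p.1 • p.2) {w₀ : W}
    (htrans' : ∀ w : W, ∃ g : G', g • w₀ = w) (h' : Measure G') [IsProbabilityMeasure h']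
    [h'.IsMulRightInvariant] (μ : Measure (X × W)) [IsProbabilityMeasure μ]
    (hμ : ∀ g : G, μ.map (fun p => (g • p.1, p.2)) = μ)
    (hμ' : ∀ g : G', (μ.map Prod.snd).map (g • ·) = μ.map Prod.snd) :
    IsUniform (G × G') μ := by
  have hg : ∀ g : G, Measurable fun x : X => g • x :=
    measurable_const_smul_of_measurable_smul hact
  have hg' : ∀ g : G', Measurable fun x : W => g • x :=
    measurable_const_smul_of_measurable_smul hact'
  have hprob : ∀ ν : Measure (X × W), IsProbabilityMeasure ν →
      IsProbabilityMeasure (ν.map Prod.snd) := fun ν _ =>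
    Measure.isProbabilityMeasure_map measurable_snd.aemeasurable
  have huniq : ∀ ν : Measure (X × W), IsProbabilityMeasure ν →
      (∀ g : G, ν.map (fun p => (g • p.1, p.2)) = ν) →
      (∀ g : G', (ν.map Prod.snd).map (g • ·) = ν.map Prod.snd) →
      ν = (h.map (· • x₀)).prod (h'.map (· • w₀)) := fun ν _ h1 h2 => by
    have := hprob ν inferInstance
    rw [← eq_map_of_transitive hact' htrans' h' _ h2]
    exact eq_prod_of_transitive hact htrans h ν h1
  have hmap : ∀ g : G × G', Measurable fun p : X × W => (g.1 • p.1, g.2 • p.2) := fun g =>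
    ((hg g.1).comp measurable_fst).prodMk ((hg' g.2).comp measurable_snd)
  have hmap1 : ∀ g : G, Measurable fun p : X × W => (g • p.1, p.2) := fun g =>
    ((hg g).comp measurable_fst).prodMk measurable_snd
  have hmap2 : ∀ g : G', Measurable fun p : X × W => (p.1, g • p.2) := fun g =>
    measurable_fst.prodMk ((hg' g).comp measurable_snd)
  refine ⟨⟨inferInstance, ⟨fun g s hs => ?_⟩⟩, fun ν hν hinv => ?_⟩
  · have := hprob μ inferInstance
    -- The moved measure satisfies the two invariance conditions that characterize `μ`.
    have h2 : μ.map (fun p => (p.1, g.2 • p.2)) = μ := by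
      have : IsProbabilityMeasure (μ.map fun p => (p.1, g.2 • p.2)) :=
        Measure.isProbabilityMeasure_map (hmap2 _).aemeasurable
      have hsnd : (μ.map fun p => (p.1, g.2 • p.2)).map Prod.snd = μ.map Prod.snd := by
        rw [Measure.map_map measurable_snd (hmap2 _)]
        conv_rhs => rw [← hμ' g.2, Measure.map_map (hg' _) measurable_snd]
        rfl
      have hk := huniq _ this (fun k => by
        rw [Measure.map_map (hmap1 _) (hmap2 _)]
        conv_rhs => rw [← hμ k, Measure.map_map (hmap2 _) (hmap1 _)]
        rfl) (fun k => by rw [hsnd, hμ'])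
      exact hk.trans (huniq μ inferInstance hμ hμ').symm
    have h3 : μ.map (fun p => g • p) = μ := by
      simp only [hsmul]
      conv_rhs => rw [← hμ g.1, ← h2, Measure.map_map (hmap1 _) (hmap2 _)]
      rfl
    have hm : Measurable fun p : X × W => g • p := by simpa only [hsmul] using hmap g
    conv_rhs => rw [← h3, Measure.map_apply hm hs]
  · have hνg : ∀ g : G × G', ν.map (fun p => (g.1 • p.1, g.2 • p.2)) = ν := fun g => by
      ext s hs
      rw [Measure.map_apply (hmap g) hs]
      simpa only [hsmul] using hinv.measure_preimage_smul g hs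
    refine (huniq ν hν (fun g => by simpa using hνg (g, 1)) fun g => ?_).trans
      (huniq μ inferInstance hμ hμ').symm
    have h1 : ν.map (fun p => (p.1, g • p.2)) = ν := by simpa using hνg (1, g)
    conv_rhs => rw [← h1, Measure.map_map measurable_snd (hmap2 _)]
    rw [Measure.map_map (hg' _) measurable_snd]
    rfl

end Homogeneous

theorem exists_isMulRightInvariant_probability (G : Type*) [Group G] [TopologicalSpace G]
    [IsTopologicalGroup G] [CompactSpace G] [MeasurableSpace G] [BorelSpace G] :
    ∃ h : Measure G, IsProbabilityMeasure h ∧ h.IsMulRightInvariant := by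
  let μ : Measure G := Measure.haarMeasure ⊤
  have : IsProbabilityMeasure μ := ⟨Measure.haarMeasure_self (K₀ := ⊤)⟩
  -- Inversion turns the left-invariant Haar measure into a right-invariant one, so unimodularity is
  -- not needed.
  exact ⟨μ.inv, ⟨by rw [Measure.inv_apply, Set.inv_univ, measure_univ]⟩, inferInstance⟩

/-! ### The law of `ξ(Y)` -/

section Main

variable {𝔽 : Type*} [NormedRing 𝔽] [StarRing 𝔽] [NormedAlgebra ℝ 𝔽] [HermitianScalars 𝔽]
variable [StarModule ℝ 𝔽] [FiniteDimensional ℝ 𝔽] [ContinuousStar 𝔽]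
variable [MeasureSpace 𝔽] [BorelSpace 𝔽] [(volume : Measure 𝔽).IsAddHaarMeasure] {m n : ℕ}

theorem measurable_smul_stiefel :
    Measurable fun p : UnitaryGroup 𝔽 m × Stiefel 𝔽 n m => p.1 • p.2 := by
  refine Continuous.measurable (Continuous.subtype_mk ?_ _)
  exact Continuous.matrix_mul (by fun_prop) (by fun_prop)

theorem measurable_smul_completeFlag (a : Fin n → ℝ) :
    Measurable fun p : UnitaryGroup 𝔽 n × CompleteFlag 𝔽 a => p.1 • p.2 := by
  refine Continuous.measurable (Continuous.subtype_mk ?_ _)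
  exact Continuous.matrix_mul (Continuous.matrix_mul (by fun_prop) (by fun_prop))
    (Continuous.matrix_conjTranspose (by fun_prop))

theorem exists_unitary_conj_eq {a : Fin n → ℝ} (F F' : CompleteFlag 𝔽 a) :
    ∃ B : UnitaryGroup 𝔽 n, B • F = F' := by
  obtain ⟨F, Q, rfl⟩ := F
  obtain ⟨F', Q', rfl⟩ := F'
  refine ⟨Q' * Q⁻¹, Subtype.ext ?_⟩
  have hQ : Q.1ᴴ * Q.1 = 1 := (Unitary.mem_iff.mp Q.2).1
  change (Q'.1 * Q.1ᴴ) * (Q.1 * realDiagonal 𝔽 a * Q.1ᴴ) * (Q'.1 * Q.1ᴴ)ᴴ = _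
  rw [Matrix.conjTranspose_mul, Matrix.conjTranspose_conjTranspose]
  simp only [Matrix.mul_assoc]
  rw [← Matrix.mul_assoc Q.1ᴴ Q.1, hQ, Matrix.one_mul, ← Matrix.mul_assoc Q.1ᴴ Q.1, hQ,
    Matrix.one_mul]

/-- The linear automorphism `Y ↦ A Y Bᴴ`. -/
def unitaryMulEquiv (A : UnitaryGroup 𝔽 m) (B : UnitaryGroup 𝔽 n) :
    Matrix (Fin m) (Fin n) 𝔽 ≃ₗ[ℝ] Matrix (Fin m) (Fin n) 𝔽 where
  toFun Y := A.1 * Y * B.1ᴴ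
  invFun Y := A.1ᴴ * Y * B.1
  map_add' Y Z := by rw [Matrix.mul_add, Matrix.add_mul]
  map_smul' c Y := by simp
  left_inv Y := by
    have hA : A.1ᴴ * A.1 = 1 := (Unitary.mem_iff.mp A.2).1
    have hB : B.1ᴴ * B.1 = 1 := (Unitary.mem_iff.mp B.2).1
    simp only [← Matrix.mul_assoc, hA, Matrix.one_mul]
    rw [Matrix.mul_assoc, hB, Matrix.mul_one]
  right_inv Y := by
    have hA : A.1 * A.1ᴴ = 1 := (Unitary.mem_iff.mp A.2).2
    have hB : B.1 * B.1ᴴ = 1 := (Unitary.mem_iff.mp B.2).2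
    simp only [← Matrix.mul_assoc, hA, Matrix.one_mul]
    rw [Matrix.mul_assoc, hB, Matrix.mul_one]

theorem frobeniusSq_unitaryMulEquiv (A : UnitaryGroup 𝔽 m) (B : UnitaryGroup 𝔽 n)
    (Y : Matrix (Fin m) (Fin n) 𝔽) : frobeniusSq (unitaryMulEquiv A B Y) = frobeniusSq Y := by
  change frobeniusSq (A.1 * Y * B.1ᴴ) = _
  rw [frobeniusSq_mul_right, frobeniusSq_mul_left (Unitary.mem_iff.mp A.2).1]
  rw [Matrix.conjTranspose_conjTranspose]
  exact (Unitary.mem_iff.mp B.2).1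

theorem measurable_unitaryMulEquiv (A : UnitaryGroup 𝔽 m) (B : UnitaryGroup 𝔽 n) :
    Measurable (unitaryMulEquiv A B) :=
  Continuous.measurable
    (Continuous.matrix_mul (Continuous.matrix_mul continuous_const continuous_id) continuous_const)

theorem singularVectors_isUniformlyDistributed {Ω : Type*} [MeasurableSpace Ω] (P : Measure Ω)
    (hnm : n ≤ m) (a : Fin n → ℝ) {β : ℝ} [IsProbabilityMeasure (ginibre 𝔽 β m n)]
    {ξ : Regular 𝔽 m n → Stiefel 𝔽 n m × CompleteFlag 𝔽 a} (hξ : IsSingularVectorsMap a ξ)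
    {Y : Ω → Matrix (Fin m) (Fin n) 𝔽} (hY : HasLaw Y (ginibre 𝔽 β m n) P) :
    (∀ᵐ ω ∂P, Y ω ∈ Regular 𝔽 m n) ∧
      ∀ Z, IsVersion P ξ Y Z →
        IsUniformlyDistributed (UnitaryGroup 𝔽 m × UnitaryGroup 𝔽 n) Z P := by
  classical
  have : SecondCountableTopology 𝔽 := secondCountable_of_finiteDimensional
  refine ⟨ae_of_ae_map hY.aemeasurable (hY.map_eq.symm ▸ ae_mem_regular hnm β), fun Z hZ => ?_⟩
  obtain ⟨Y₀, hY₀⟩ := exists_mem_regular (𝔽 := 𝔽) hnm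
  -- A measurable extension of `ξ` to all matrices, constant off the regular set; that set has full
  -- measure, so the constant does not affect the law.
  obtain ⟨Ξ, hΞ, hΞξ⟩ : ∃ Ξ : Matrix (Fin m) (Fin n) 𝔽 → Stiefel 𝔽 n m × CompleteFlag 𝔽 a,
      Measurable Ξ ∧ ∀ Y : Regular 𝔽 m n, Ξ Y.1 = ξ Y :=
    ⟨fun Y => if h : Y ∈ Regular 𝔽 m n then ξ ⟨Y, h⟩ else ξ ⟨Y₀, hY₀⟩,
      Measurable.dite hξ.continuous.measurable measurable_const measurableSet_regular,
      fun Y => dif_pos Y.2⟩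
  have hZΞ : Z =ᵐ[P] Ξ ∘ Y := by
    filter_upwards [hZ] with ω ⟨h, hω⟩
    rw [hω, Function.comp_apply, ← hΞξ]
  have hlaw : P.map Z = (ginibre 𝔽 β m n).map Ξ := by
    rw [Measure.map_congr hZΞ, ← hY.map_eq,
      AEMeasurable.map_map_of_aemeasurable hΞ.aemeasurable hY.aemeasurable]
  refine ⟨⟨_, hΞ.comp_aemeasurable hY.aemeasurable |>.measurable_mk,
    hZΞ.trans (hΞ.comp_aemeasurable hY.aemeasurable).ae_eq_mk⟩, ?_⟩
  rw [hlaw]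
  have hprob : IsProbabilityMeasure ((ginibre 𝔽 β m n).map Ξ) :=
    Measure.isProbabilityMeasure_map hΞ.aemeasurable
  have hequi : ∀ (A : UnitaryGroup 𝔽 m) (B : UnitaryGroup 𝔽 n), ∀ Y ∈ Regular 𝔽 m n,
      (Ξ (unitaryMulEquiv A B Y)).1.1 = A.1 * (Ξ Y).1.1 * B.1ᴴ ∧
        (Ξ (unitaryMulEquiv A B Y)).2 = B • (Ξ Y).2 := fun A B Y hY => by
    obtain ⟨h, h1⟩ := hξ.unitary_mul A B ⟨Y, hY⟩
    have e1 : Ξ (unitaryMulEquiv A B Y) = ξ ⟨_, h⟩ := hΞξ ⟨_, h⟩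
    have e2 : Ξ Y = ξ ⟨Y, hY⟩ := hΞξ ⟨Y, hY⟩
    rwa [e1, e2]
  obtain ⟨h, _, _⟩ := exists_isMulRightInvariant_probability (UnitaryGroup 𝔽 m)
  obtain ⟨h', _, _⟩ := exists_isMulRightInvariant_probability (UnitaryGroup 𝔽 n)
  have hA : ∀ A : UnitaryGroup 𝔽 m, Measurable fun X : Stiefel 𝔽 n m => A • X :=
    measurable_const_smul_of_measurable_smul measurable_smul_stiefel
  have hB : ∀ B : UnitaryGroup 𝔽 n, Measurable fun F : CompleteFlag 𝔽 a => B • F :=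
    measurable_const_smul_of_measurable_smul (measurable_smul_completeFlag a)
  have hsmul : ∀ (g : UnitaryGroup 𝔽 m × UnitaryGroup 𝔽 n)
      (p : Stiefel 𝔽 n m × CompleteFlag 𝔽 a), g • p = (g.1 • p.1, g.2 • p.2) := fun _ _ => rfl
  have ht : ∀ X : Stiefel 𝔽 n m, ∃ A : UnitaryGroup 𝔽 m, A • (ξ ⟨Y₀, hY₀⟩).1 = X :=
    exists_unitary_mul_eq hnm _
  have ht' : ∀ F : CompleteFlag 𝔽 a, ∃ B : UnitaryGroup 𝔽 n, B • (ξ ⟨Y₀, hY₀⟩).2 = F :=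
    exists_unitary_conj_eq _
  have hmg : MeasurableMul (UnitaryGroup 𝔽 m) := inferInstance
  have hmg' : MeasurableMul (UnitaryGroup 𝔽 n) := inferInstance
  have key := isUniform_prod hsmul measurable_smul_stiefel ht h
    (measurable_smul_completeFlag a) ht' h' ((ginibre 𝔽 β m n).map Ξ)
  refine key (fun A => ?_) (fun B => ?_)
  · conv_rhs => rw [← map_ginibre (unitaryMulEquiv A 1) (frobeniusSq_unitaryMulEquiv A 1),
      Measure.map_map hΞ (measurable_unitaryMulEquiv A 1)]
    have hm : Measurable fun p : Stiefel 𝔽 n m × CompleteFlag 𝔽 a => (A • p.1, p.2) :=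
      ((hA A).comp measurable_fst).prodMk measurable_snd
    rw [Measure.map_map hm hΞ]
    refine Measure.map_congr ?_
    filter_upwards [ae_mem_regular hnm β] with Y hY
    obtain ⟨h1, h2⟩ := hequi A 1 Y hY
    have h3 : A • (Ξ Y).1 = (Ξ (unitaryMulEquiv A 1 Y)).1 := Subtype.ext (by
      change A.1 * (Ξ Y).1.1 = _
      rw [h1]
      simp)
    rw [one_smul] at h2
    exact Prod.ext h3 h2.symm
  -- Only the flag component is compared: the Stiefel component becomes `X Bᴴ`.
  · conv_rhs => rw [← map_ginibre (unitaryMulEquiv 1 B) (frobeniusSq_unitaryMulEquiv 1 B),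
      Measure.map_map hΞ (measurable_unitaryMulEquiv 1 B),
      Measure.map_map measurable_snd (hΞ.comp (measurable_unitaryMulEquiv 1 B))]
    rw [Measure.map_map measurable_snd hΞ, Measure.map_map (hB B) (measurable_snd.comp hΞ)]
    refine Measure.map_congr ?_
    filter_upwards [ae_mem_regular hnm β] with Y hY
    exact (hequi 1 B Y hY).2.symm

end Main

/-! ### The three scalar algebras -/

noncomputable instance : HermitianScalars ℝ where
  re := LinearMap.id
  re_one := rfl
  re_mul_comm x y := mul_comm x y
  re_star _ := rfl
  star_mul_self x := by simp [sq]

noncomputable instance : HermitianScalars ℂ where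
  re := Complex.reLm
  re_one := rfl
  re_mul_comm x y := by rw [mul_comm]
  re_star x := by simp
  star_mul_self x := by simp [← Complex.normSq_eq_conj_mul_self, Complex.normSq_eq_norm_sq]

instance : StarModule ℝ (Quaternion ℝ) := ⟨fun r x => by
  rw [Quaternion.star_smul, star_trivial r]⟩

noncomputable instance : HermitianScalars (Quaternion ℝ) where
  re := { toFun := fun x => x.re, map_add' := fun _ _ => rfl, map_smul' := fun _ _ => rfl }
  re_one := rfl
  re_mul_comm x y := by
    change (x * y).re = (y * x).re
    rw [Quaternion.re_mul, Quaternion.re_mul]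
    ring
  re_star x := Quaternion.re_star x
  star_mul_self x := by
    rw [Quaternion.star_mul_self, Quaternion.normSq_eq_norm_mul_self, sq]
    rfl

/-- `β` is the real dimension of the scalars, which is why one constant normalizes all three
ensembles. -/
theorem integral_gaussian_of_innerProductSpace (V : Type*) [NormedAddCommGroup V]
    [InnerProductSpace ℝ V] [FiniteDimensional ℝ V] [MeasurableSpace V] [BorelSpace V] {β : ℝ}
    (hβ : 0 < β) (hV : (Module.finrank ℝ V : ℝ) = β) :
    ∫ x : V, Real.exp (-(β / 2) * ‖x‖ ^ 2) = (2 * Real.pi / β) ^ (β / 2) := by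
  rw [GaussianFourier.integral_rexp_neg_mul_sq_norm (half_pos hβ), hV]
  congr 1
  field_simp

theorem isProbabilityMeasure_GinOE (m n : ℕ) : IsProbabilityMeasure (GinOE m n) :=
  isProbabilityMeasure_ginibre one_pos (integral_gaussian_of_innerProductSpace ℝ one_pos (by simp))

theorem isProbabilityMeasure_GinUE (m n : ℕ) : IsProbabilityMeasure (GinUE m n) :=
  isProbabilityMeasure_ginibre two_pos
    (integral_gaussian_of_innerProductSpace ℂ two_pos (by simp [Complex.finrank_real_complex]))

theorem isProbabilityMeasure_GinSE (m n : ℕ) : IsProbabilityMeasure (GinSE m n) :=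
  isProbabilityMeasure_ginibre four_pos
    (integral_gaussian_of_innerProductSpace (Quaternion ℝ) four_pos
      (by simp [Quaternion.finrank_eq_four]))

end SingularVectors

theorem mainTheorem4 {Ω : Type*} [MeasurableSpace Ω] (P : Measure Ω)
    (m n : ℕ) (hn : 0 < n) (hnm : n ≤ m) (a : Fin n → ℝ) (ha : Function.Injective a) :
    -- the real case
    ((∃! ξ : Regular ℝ m n → Stiefel ℝ n m × CompleteFlag ℝ a, IsSingularVectorsMap a ξ) ∧
      ∀ ξ : Regular ℝ m n → Stiefel ℝ n m × CompleteFlag ℝ a, IsSingularVectorsMap a ξ →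
        ∀ Y : Ω → Matrix (Fin m) (Fin n) ℝ, HasLaw Y (GinOE m n) P →
          (∀ᵐ ω ∂P, Y ω ∈ Regular ℝ m n) ∧
          ∀ Z, IsVersion P ξ Y Z →
            IsUniformlyDistributed (UnitaryGroup ℝ m × UnitaryGroup ℝ n) Z P) ∧
    -- the complex case
    ((∃! ξ : Regular ℂ m n → Stiefel ℂ n m × CompleteFlag ℂ a, IsSingularVectorsMap a ξ) ∧
      ∀ ξ : Regular ℂ m n → Stiefel ℂ n m × CompleteFlag ℂ a, IsSingularVectorsMap a ξ →
        ∀ Y : Ω → Matrix (Fin m) (Fin n) ℂ, HasLaw Y (GinUE m n) P →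
          (∀ᵐ ω ∂P, Y ω ∈ Regular ℂ m n) ∧
          ∀ Z, IsVersion P ξ Y Z →
            IsUniformlyDistributed (UnitaryGroup ℂ m × UnitaryGroup ℂ n) Z P) ∧
    -- the quaternionic case
    ((∃! ξ : Regular (Quaternion ℝ) m n →
          Stiefel (Quaternion ℝ) n m × CompleteFlag (Quaternion ℝ) a, IsSingularVectorsMap a ξ) ∧
      ∀ ξ : Regular (Quaternion ℝ) m n →
          Stiefel (Quaternion ℝ) n m × CompleteFlag (Quaternion ℝ) a, IsSingularVectorsMap a ξ →
        ∀ Y : Ω → Matrix (Fin m) (Fin n) (Quaternion ℝ), HasLaw Y (GinSE m n) P →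
          (∀ᵐ ω ∂P, Y ω ∈ Regular (Quaternion ℝ) m n) ∧
          ∀ Z, IsVersion P ξ Y Z →
            IsUniformlyDistributed
              (UnitaryGroup (Quaternion ℝ) m × UnitaryGroup (Quaternion ℝ) n) Z P) := by

  refine ⟨⟨existsUnique_isSingularVectorsMap ℝ m a, fun ξ hξ Y hY => ?_⟩,
    ⟨existsUnique_isSingularVectorsMap ℂ m a, fun ξ hξ Y hY => ?_⟩,
    ⟨existsUnique_isSingularVectorsMap (Quaternion ℝ) m a, fun ξ hξ Y hY => ?_⟩⟩
  · have : IsProbabilityMeasure (ginibre ℝ 1 m n) := isProbabilityMeasure_GinOE m n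
    exact singularVectors_isUniformlyDistributed P hnm a hξ hY
  · have : IsProbabilityMeasure (ginibre ℂ 2 m n) := isProbabilityMeasure_GinUE m n
    exact singularVectors_isUniformlyDistributed P hnm a hξ hY
  · have : IsProbabilityMeasure (ginibre (Quaternion ℝ) 4 m n) := isProbabilityMeasure_GinSE m n
    exact singularVectors_isUniformlyDistributed P hnm a hξ hY
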